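/- **Setting.** Let $\kappa>0$, $r=\frac{\sqrt{2\kappa+1}-1}{2}$, and let $\alpha(t)=1$ for $0\le t\le r$ and $\alpha(t)=\frac{\kappa}{2t(1+t)}$ for $t>r$. For data points $x_1,\dots,x_m\in\mathbb R^n$ ($n,m\ge 1$) with labels $|f(x_i)|\le 1$, put $$\mathcal L(\phi,z)=\frac1m\sum_{i=1}^m\alpha(\|x_i-z\|)\,\bigl(\phi^\top(x_i-z)-f(x_i)\bigr)^2,\qquad \mathcal L^*(z)=\min_{\|\phi\|_2\le1}\mathcal L(\phi,z).$$ Gradients are taken in $\phi$. *Noisy gradient descent* for $z$, with initial point $\phi$, noise level $\sigma$ and $T'$ iterates, sets $\phi^{\{1\}}=\phi$, lets $\phi^{\{t+1\}}$ (for $1\le t<T'$) be the nearest point of the closed unit ball to $\phi^{\{t\}}-\eta(t)\bigl[\nabla\mathcal L(\phi^{\{t\}},z)+\sigma Z_t\bigr]$ with independent standard Gaussian vectors $Z_t$, and returns $\phi^{\{T'\}}$. Here $\eta(t)=c/\sqrt t$, where $c=\rho(n,T,T',\sigma,\beta)>0$ is given by a learning rate rule $\rho$, and $\beta=\|\nabla\mathcal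 L(\phi,z)\|$. *The adaptive protocol.* Given $T\ge2$, $\epsilon_{\min}>0$, $0<\delta_{\min}<1$, a total budget $(\epsilon,\delta)$, and a fixed sequence of queries $z_0,z_1,\dots\in\mathbb R^n$, put $$\epsilon_{ite}=\frac{\epsilon_{\min}}{\sqrt{8T\log(2/\delta_{\min})}},\qquad \sigma_{\min}=\frac{\sqrt{2\log(2.5\,T/\delta_{\min})}}{m\,\epsilon_{ite}},\qquad d=\frac{\log T}{\sqrt T}.$$ Query $z_h$ is answered by $\phi^{Priv}(z_h)$ as follows. 1. If some earlier query $z_j$ that was itself answered by gradient descent satisfies $\|z_h-z_j\|\le d$, then $\phi^{Priv}(z_h)=\phi^{Priv}(z_j)$ for one such $j$ (chosen by any fixed function of the queries), and we put $s(h)=j$. 2. Otherwise $s(h)=h$ and $\phi^{Priv}(z_h)$ is the output of noisy gradient descent for $z_h$. For $h=0$ it starts from an arbitrary point of the unit ball, with $\sigma=\sigma_{\min}$ and $T'=T$. For $h>0$ it starts from $\phi^{Priv}(z_j)$, where $j<h$ is drawn with probability proportional to $\exp\bigl(-m\,\epsilon_{ite}\|\nabla\mathcal L(\phi^{Priv}(z_j),z_h)\|/2\bigr)$.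 With $\beta$ the norm of the gradient at this starting point, $\sigma=\max(\beta/\sqrt n,\sigma_{\min})$ and $a=\log\frac1{\sqrt n\sigma}\big/\log\log T$, the number of iterates is $T'=\lceil(\sqrt n\,\sigma)^{1-\frac1{2a}}T\rceil$ if $a>\frac12$, and $T'=T$ otherwise. At each gradient descent query, the spent budget $(\epsilon_{spent},\delta_{spent})$ is computed by an arbitrary fixed measurable rule from the noise levels and iteration numbers used so far. If $\epsilon_{spent}>\epsilon$ or $\delta_{spent}\ge\delta$, the protocol stops without releasing this answer; otherwise every answer is released. Let $R_h$ be the event that the answer to $z_h$ is released, and let $$\mathcal E_h=\mathbb E\bigl[\mathcal L(\phi^{Priv}(z_h),z_h)\,\big|\,R_{s(h)}\bigr]-\mathcal L^*(z_h)$$ if $\Pr[R_{s(h)}]>0$. If the budget is never exhausted, this is $\mathbb E[\mathcal L(\phi^{Priv}(z_h),z_h)]-\mathcal L^*(z_h)$. **Theorem.** For every $\kappa>0$ there is a learning rate rule $\rho>0$ such that the following hold. (i) For every $K$ there is a constant $C$, depending only on $\kappa$ and $K$, such that in every setting as above with $\sqrt n\,\sigma_{\min}\le K$, and for every query $z_h$,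 reused or not, $$\mathcal E_h\le C\,\frac{\log T}{\sqrt T},\qquad \mathbb E\bigl[(\mathcal L(\phi^{Priv}(z_h),z_h)-\mathcal L^*(z_h))\,\mathbf 1_{R_h}\bigr]\le C\,\frac{\log T}{\sqrt T}.$$ (ii) For all $\epsilon_{\min}>0$ and $\delta_{\min}\in(0,1)$ there is a constant $C$, depending only on $\kappa,\epsilon_{\min},\delta_{\min}$, such that in every setting as above with these privacy parameters, $m>n/\epsilon_{ite}$ and $T=\sqrt m$ (rounded to an integer up or down), and for every query $z_h$, both quantities in (i) are at most $C\,\frac{\log m}{m^{1/4}}$. -/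

import Mathlib

open MeasureTheory ProbabilityTheory

noncomputable section

namespace AdaptiveDP

/-- Points of interest, data points and explanations live in Euclidean `n`-space. -/
abbrev Pt (n : ℕ) := EuclideanSpace ℝ (Fin n)

/-! ### The local loss -/

/-- The stable weight function `α` with parameter `κ > 0`: it is `1` up to the radius
`(√(2κ+1) - 1)/2` and `κ / (2 t (1 + t))` beyond it. -/
def weight (κ t : ℝ) : ℝ :=
  if t ≤ (√(2 * κ + 1) - 1) / 2 then 1 else κ / (2 * t * (1 + t))

/-- Empirical local loss of the linear function `φ` around `z`, over the data points `x i`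
labelled by `f`. -/
def loss (κ : ℝ) {n m : ℕ} (x : Fin m → Pt n) (f : Pt n → ℝ) (z φ : Pt n) : ℝ :=
  (1 / (m : ℝ)) * ∑ i, weight κ ‖x i - z‖ * (inner ℝ φ (x i - z) - f (x i)) ^ 2

/-- The loss of an optimal explanation at `z`, i.e. the minimum of the loss over the closed
Euclidean unit ball (it is attained, see `exists_optimal`). -/
def optLoss (κ : ℝ) {n m : ℕ} (x : Fin m → Pt n) (f : Pt n → ℝ) (z : Pt n) : ℝ :=
  sInf (loss κ x f z '' Metric.closedBall 0 1)

theorem exists_optimal (κ : ℝ) {n m : ℕ} (x : Fin m → Pt n) (f : Pt n → ℝ) (z : Pt n) :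
    ∃ φ ∈ Metric.closedBall (0 : Pt n) 1, loss κ x f z φ = optLoss κ x f z ∧
      ∀ ψ ∈ Metric.closedBall (0 : Pt n) 1, loss κ x f z φ ≤ loss κ x f z ψ := by
  have hc : Continuous (loss κ x f z) := by unfold loss; fun_prop
  obtain ⟨φ, hφ, h1, h2⟩ := (isCompact_closedBall (0 : Pt n) 1).exists_sInf_image_eq_and_le
    (Metric.nonempty_closedBall.2 zero_le_one) hc.continuousOn
  exact ⟨φ, hφ, h1.symm, h2⟩

/-- The gradient of the loss in `φ`. -/
def lossGrad (κ : ℝ) {n m : ℕ} (x : Fin m → Pt n) (f : Pt n → ℝ) (z φ : Pt n) : Pt n :=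
  gradient (loss κ x f z) φ

/-! ### Noisy projected gradient descent -/

/-- The nearest point of the closed unit ball. -/
def projBall {n : ℕ} (ξ : Pt n) : Pt n := if ‖ξ‖ ≤ 1 then ξ else ‖ξ‖⁻¹ • ξ

theorem projBall_nearest {n : ℕ} (ξ : Pt n) :
    ‖projBall ξ‖ ≤ 1 ∧ ∀ φ : Pt n, ‖φ‖ ≤ 1 → ‖projBall ξ - ξ‖ ≤ ‖φ - ξ‖ := by
  unfold projBall
  split_ifs with h
  · exact ⟨h, fun φ _ => by simp⟩
  · push Not at h
    have h0 : 0 < ‖ξ‖ := by linarith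
    refine ⟨by rw [norm_smul, norm_inv, norm_norm, inv_mul_cancel₀ h0.ne'], fun φ hφ => ?_⟩
    have h1 : ‖ξ‖⁻¹ • ξ - ξ = (‖ξ‖⁻¹ - 1) • ξ := by rw [sub_smul, one_smul]
    have h2 : ‖ξ‖⁻¹ ≤ 1 := inv_le_one_of_one_le₀ h.le
    have h3 : ‖ξ‖ - ‖φ‖ ≤ ‖φ - ξ‖ := by
      rw [norm_sub_rev]; exact norm_sub_norm_le _ _
    rw [h1, norm_smul, Real.norm_eq_abs, abs_of_nonpos (by linarith), neg_sub, sub_mul,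
      inv_mul_cancel₀ h0.ne']
    linarith

/-- The iterates `φ^{1}, φ^{2}, …` (here numbered from `0`) of noisy projected gradient descent
for the gradient field `g`, with learning rate `η(t) = c/√t`, noise level `σ`, standard
Gaussian noise vectors `Z` and initial point `φ`. -/
def dpGrad {n : ℕ} (g : Pt n → Pt n) (c σ : ℝ) (Z : ℕ → Pt n) (φ : Pt n) : ℕ → Pt n
  | 0 => φ
  | k + 1 => projBall (dpGrad g c σ Z φ k -
      (c / √((k : ℝ) + 1)) • (g (dpGrad g c σ Z φ k) + σ • Z k))

/-! ### Parameters -/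

/-- Privacy budget per iteration. -/
def epsIte (T : ℕ) (εmin δmin : ℝ) : ℝ := εmin / √(8 * T * Real.log (2 / δmin))

/-- Minimal noise level of the Gaussian mechanism. -/
def sigmaMin (m T : ℕ) (εmin δmin : ℝ) : ℝ :=
  √(2 * Real.log (2.5 * T / δmin)) / (m * epsIte T εmin δmin)

/-- Number `T'` of iterates for a warm start with noise level `σ` (rounded up to an integer). -/
def warmIters (n T : ℕ) (σ : ℝ) : ℕ :=
  let a : ℝ := Real.log (1 / (√n * σ)) / Real.log (Real.log T)
  if 1 / 2 < a then ⌈(√n * σ) ^ (1 - 1 / (2 * a)) * T⌉₊ else T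

/-- Sampling from `{0, …, k-1}` with probabilities proportional to the positive weights `w`, by
inverting the cumulative distribution function at a uniform `u ∈ [0,1]`: the result is the
number of `j < k - 1` with `w 0 + … + w j ≤ u (w 0 + … + w (k-1))`. -/
def sample (k : ℕ) (w : ℕ → ℝ) (u : ℝ) : ℕ :=
  ((Finset.range (k - 1)).filter fun j =>
    ∑ i ∈ Finset.range (j + 1), w i ≤ u * ∑ i ∈ Finset.range k, w i).card

theorem sample_eq {k : ℕ} {w : ℕ → ℝ} (hw : ∀ i, 0 < w i) {j : ℕ} (hj : j < k) {u : ℝ}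
    (h1 : ∑ i ∈ Finset.range j, w i ≤ u * ∑ i ∈ Finset.range k, w i)
    (h2 : u * ∑ i ∈ Finset.range k, w i < ∑ i ∈ Finset.range (j + 1), w i) : sample k w u = j := by
  have mono : Monotone fun l => ∑ i ∈ Finset.range l, w i := fun a b hab =>
    Finset.sum_le_sum_of_subset_of_nonneg (Finset.range_mono hab) fun i _ _ => (hw i).le
  have : (Finset.range (k - 1)).filter (fun j =>
    ∑ i ∈ Finset.range (j + 1), w i ≤ u * ∑ i ∈ Finset.range k, w i) = Finset.range j := by
    ext l
    simp only [Finset.mem_filter, Finset.mem_range]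
    constructor
    · rintro ⟨_, h⟩
      by_contra hl
      have := mono (show j + 1 ≤ l + 1 by omega)
      simp only at this
      linarith
    · intro hl
      have := mono (show l + 1 ≤ j by omega)
      simp only at this
      exact ⟨by omega, this.trans h1⟩
  rw [sample, this, Finset.card_range]

/-- For a uniform `u`, the result of `sample` is `j` with probability `w j / (w 0 + … + w (k-1))`. -/
theorem volume_sample {k : ℕ} {w : ℕ → ℝ} (hw : ∀ i, 0 < w i) {j : ℕ} (hj : j < k) :
    volume {u : unitInterval | sample k w u = j} =
      ENNReal.ofReal (w j / ∑ i ∈ Finset.range k, w i) := by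
  have mono : Monotone fun l => ∑ i ∈ Finset.range l, w i := fun a b hab =>
    Finset.sum_le_sum_of_subset_of_nonneg (Finset.range_mono hab) fun i _ _ => (hw i).le
  set W := ∑ i ∈ Finset.range k, w i with hW
  have hWpos : 0 < W := Finset.sum_pos (fun i _ => hw i) ⟨j, by simpa using hj⟩
  have mem : ∀ l ≤ k, (∑ i ∈ Finset.range l, w i) / W ∈ Set.Icc (0 : ℝ) 1 := fun l hl =>
    ⟨div_nonneg (Finset.sum_nonneg fun i _ => (hw i).le) hWpos.le,
      (div_le_one hWpos).2 (mono hl)⟩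
  let c : ℕ → unitInterval := fun l => if hl : l ≤ k then ⟨_, mem l hl⟩ else 0
  have hc : ∀ l ≤ k, (c l : ℝ) = (∑ i ∈ Finset.range l, w i) / W := fun l hl => by
    simp only [c]; rw [dif_pos hl]
  have hae : {u : unitInterval | sample k w u = j} =ᵐ[volume] Set.Ico (c j) (c (j + 1)) := by
    have hne : ∀ᵐ u : unitInterval, u ≠ 1 := by
      rw [ae_iff]; simp
    filter_upwards [hne] with u hu
    apply propext
    change sample k w u = j ↔ c j ≤ u ∧ u < c (j + 1)
    rw [← Subtype.coe_le_coe, ← Subtype.coe_lt_coe, hc j hj.le, hc (j + 1) hj,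
      div_le_iff₀ hWpos, lt_div_iff₀ hWpos]
    have hu1 : (u : ℝ) < 1 := lt_of_le_of_ne u.2.2 fun h => hu (Subtype.ext h)
    refine ⟨fun h => ?_, fun h => sample_eq hw hj h.1 h.2⟩
    have hex : ∃ l, (u : ℝ) * W < ∑ i ∈ Finset.range (l + 1), w i := ⟨k - 1, by
      rw [Nat.sub_add_cancel (by omega)]; nlinarith⟩
    classical
    have h2 := Nat.find_spec hex
    have h3 : ∑ i ∈ Finset.range (Nat.find hex), w i ≤ u * W := by
      rcases hl : Nat.find hex with _ | l
      · simpa using mul_nonneg u.2.1 hWpos.le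
      · exact not_lt.1 (Nat.find_min hex (by omega))
    have h4 : Nat.find hex < k := by
      have : Nat.find hex ≤ k - 1 := Nat.find_min' hex (by
        rw [Nat.sub_add_cancel (by omega)]; nlinarith)
      omega
    have h5 := sample_eq hw h4 h3 h2
    rw [h] at h5
    rw [← h5] at h2 h3
    exact ⟨h3, h2⟩
  rw [measure_congr hae, unitInterval.volume_Ico, hc j hj.le, hc (j + 1) hj,
    Finset.sum_range_succ]
  congr 1
  ring

/-- `src` records, for the queries `z 0, z 1, …` and the distance bound `d`, which gradient descent
run each answer comes from. A query `h` has the flag `⊤` iff `src h = h`. If some earlier query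
with flag `⊤` lies within distance `d` of `z h`, then `src h` is such a query (any one of them) and
its explanation is reused; otherwise `src h = h`, and gradient descent is run for `h`. -/
def IsSource {n : ℕ} (z : ℕ → Pt n) (d : ℝ) (src : ℕ → ℕ) : Prop :=
  ∀ h, (src h < h ∧ src (src h) = src h ∧ ‖z h - z (src h)‖ ≤ d) ∨
    (src h = h ∧ ∀ j < h, src j = j → d < ‖z h - z j‖)

open Classical in
/-- For all queries there is such a `src`. -/
theorem exists_isSource {n : ℕ} (z : ℕ → Pt n) (d : ℝ) : ∃ src, IsSource z d src := by
  let F : (h : ℕ) → ((j : ℕ) → j < h → ℕ) → ℕ := fun h ih =>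
    if H : ∃ j, ∃ hj : j < h, ih j hj = j ∧ ‖z h - z j‖ ≤ d then H.choose else h
  let src : ℕ → ℕ := Nat.lt_wfRel.wf.fix F
  have hsrc : ∀ h, src h = F h (fun j _ => src j) := fun h => by
    exact Nat.lt_wfRel.wf.fix_eq F h
  refine ⟨src, fun h => ?_⟩
  rw [hsrc h]
  by_cases H : ∃ j, ∃ hj : j < h, src j = j ∧ ‖z h - z j‖ ≤ d
  · left
    have : F h (fun j _ => src j) = H.choose := by simp only [F]; rw [dif_pos H]
    rw [this]
    obtain ⟨h1, h2, h3⟩ := H.choose_spec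
    exact ⟨h1, h2, h3⟩
  · right
    have : F h (fun j _ => src j) = h := by simp only [F]; rw [dif_neg H]
    refine ⟨this, fun j hj hs => ?_⟩
    by_contra hc
    exact H ⟨j, hj, hs, not_lt.1 hc⟩

/-- The inputs of the protocol, for a data set of `m` points in dimension `n`. -/
structure Input (n m : ℕ) where
  /-- the explanation data set -/
  x : Fin m → Pt n
  /-- the model that labels it -/
  f : Pt n → ℝ
  /-- the sequence of queries -/
  z : ℕ → Pt n
  /-- maximal number of gradient descent iterates -/
  T : ℕ
  /-- minimal privacy loss per query -/
  εmin : ℝ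
  δmin : ℝ
  /-- total privacy budget -/
  ε : ℝ
  δ : ℝ
  /-- the arbitrary initial vector for the first query -/
  φ₀ : Pt n
  /-- the choice of the nearby query whose explanation is reused -/
  src : ℕ → ℕ
  /-- the rule that bounds the budget `(ε_spent, δ_spent)` spent up to query `h` by means of the
  noise levels and iteration numbers used for the queries `0, …, h` (both are `0` for a query
  that was answered by reuse); any rule is allowed -/
  spent : (h : ℕ) → (Fin (h + 1) → ℝ × ℕ) → ℝ × ℝ
  label_le : ∀ i, |f (x i)| ≤ 1
  εmin_pos : 0 < εmin
  δmin_pos : 0 < δmin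
  δmin_lt : δmin < 1
  two_le_T : 2 ≤ T
  init_le : ‖φ₀‖ ≤ 1
  isSource : IsSource z (Real.log T / √T) src
  measurable_spent : ∀ h, Measurable (spent h)

/-- A learning rate rule: the constant `c` in `η(t) = c/√t`, as a function of the dimension `n`,
the maximal number of iterates `T`, the number of iterates `T'`, the noise level `σ`, and the norm
`β` of the gradient of the loss at the initial point. -/
abbrev RateRule := ℕ → ℕ → ℕ → ℝ → ℝ → ℝ

/-! ### The adaptive protocol -/

/-- The randomness: query `h` uses the standard Gaussian vectors `(ω h).1 0, (ω h).1 1, …` for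
gradient descent and the uniform number `(ω h).2` for the exponential mechanism. -/
abbrev Noise (n : ℕ) := ℕ → (ℕ → Pt n) × unitInterval

/-- All these random variables are independent. -/
def noiseLaw (n : ℕ) : Measure (Noise n) :=
  Measure.infinitePi fun _ : ℕ =>
    (Measure.infinitePi fun _ : ℕ => stdGaussian (Pt n)).prod (volume : Measure unitInterval)

namespace Input

variable {n m : ℕ}

/-- Parameter selection for query `h`: initial point, noise level and number of iterates, given
the explanations `past 0, …, past (h-1)` of the earlier queries. -/
def params (κ : ℝ) (I : Input n m) (h : ℕ) (past : ℕ → Pt n) (u : unitInterval) :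
    Pt n × ℝ × ℕ :=
  if h = 0 then (I.φ₀, sigmaMin m I.T I.εmin I.δmin, I.T)
  else
    let best := past (sample h (fun j => Real.exp
      (-(m * epsIte I.T I.εmin I.δmin * (‖lossGrad κ I.x I.f (I.z h) (past j)‖ / 2)))) u)
    let β := ‖lossGrad κ I.x I.f (I.z h) best‖
    let σ := max (β / √n) (sigmaMin m I.T I.εmin I.δmin)
    (best, σ, warmIters n I.T σ)

/-- The explanation for query `h`, given those of the earlier queries: a reused one, or the last
iterate `φ^{T'}` of gradient descent. -/
def next (κ : ℝ) (ρ : RateRule) (I : Input n m) (h : ℕ) (past : ℕ → Pt n)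
    (ζ : (ℕ → Pt n) × unitInterval) : Pt n :=
  if I.src h < h then past (I.src h)
  else
    let p := I.params κ h past ζ.2
    let β := ‖lossGrad κ I.x I.f (I.z h) p.1‖
    dpGrad (lossGrad κ I.x I.f (I.z h)) (ρ n I.T p.2.2 p.2.1 β) p.2.1 ζ.1 p.1 (p.2.2 - 1)

/-- The history after `h` queries; only its entries `0, …, h-1` matter. -/
def history (κ : ℝ) (ρ : RateRule) (I : Input n m) (ω : Noise n) : ℕ → ℕ → Pt n
  | 0 => fun _ => 0
  | h + 1 => Function.update (I.history κ ρ ω h) h (I.next κ ρ h (I.history κ ρ ω h) (ω h))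

/-- The explanation of query `h` (as long as the protocol has not stopped). -/
def answer (κ : ℝ) (ρ : RateRule) (I : Input n m) (h : ℕ) (ω : Noise n) : Pt n :=
  I.next κ ρ h (I.history κ ρ ω h) (ω h)

/-- Noise level and number of iterates used for query `h`; `(0, 0)` if the answer is reused. -/
def used (κ : ℝ) (ρ : RateRule) (I : Input n m) (ω : Noise n) (h : ℕ) : ℝ × ℕ :=
  if I.src h < h then (0, 0) else (I.params κ h (I.history κ ρ ω h) (ω h).2).2

/-- The event that the explanation of query `h` is released: at no gradient descent query up to
and including `h` was the total privacy budget exhausted. -/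
def released (κ : ℝ) (ρ : RateRule) (I : Input n m) (h : ℕ) : Set (Noise n) :=
  {ω | ∀ j ≤ h, I.src j = j →
    ¬ (I.ε < (I.spent j fun i => I.used κ ρ ω i).1 ∨
       I.δ ≤ (I.spent j fun i => I.used κ ρ ω i).2)}

/-- The loss, around its own query, of the explanation of query `h`. -/
def answerLoss (κ : ℝ) (ρ : RateRule) (I : Input n m) (h : ℕ) (ω : Noise n) : ℝ :=
  loss κ I.x I.f (I.z h) (I.answer κ ρ h ω)

/-- The utility loss of the explanation of query `h`: its expected loss minus the optimal loss.
The expectation is conditional on the release of the gradient descent output that answers query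
`h` (this is query `h` itself unless an explanation is reused). -/
def utilityLoss (κ : ℝ) (ρ : RateRule) (I : Input n m) (h : ℕ) : ℝ :=
  ∫ ω, I.answerLoss κ ρ h ω ∂(noiseLaw n)[|I.released κ ρ (I.src h)] -
    optLoss κ I.x I.f (I.z h)

/-- Every released explanation has utility loss at most `B`. The last conjunct is the expected
excess loss on the event that the explanation of query `h` is released. -/
def UtilityBound (κ : ℝ) (ρ : RateRule) (I : Input n m) (B : ℝ) : Prop :=
  ∀ h, Integrable (I.answerLoss κ ρ h) (noiseLaw n) ∧
    MeasurableSet (I.released κ ρ h) ∧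
    I.utilityLoss κ ρ h ≤ B ∧
    ∫ ω in I.released κ ρ h, (I.answerLoss κ ρ h ω - optLoss κ I.x I.f (I.z h)) ∂(noiseLaw n) ≤ B

end Input

end AdaptiveDP

end

/-!
Proof idea. The data enter through a quadratic loss whose gradient is bounded by `κ` on the unit
ball and is `κ`-Lipschitz, because `t (1 + t) α(t) ≤ κ / 2`. Each gradient descent query is analysed
conditionally on everything but its own Gaussian noise. The release of the answer is decided by that
conditioning (`mem_released_congr`), so an accuracy that holds for every history survives restriction
to, and conditioning on, the release event (`integral_noiseLaw_nonpos`,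
`setIntegral_source_excess_le`). In particular the quality of the sampled initial point plays no
role: the number of iterates and the noise level adapt to its gradient.

For a single run, `last_iterate_le` is a last-iterate version of the usual regret bound. It compares
the suffixes of the run with their own first elements, in the manner of Shamir and Zhang, but lets
the second moment of the stochastic gradient grow linearly with the excess loss. With `s = √n σ`,
the learning rate rule distinguishes three cases (`run_excess_le`).

* Runs of full length `T`: the second moment is bounded and `c = 1` gives `log T / √T`.
* Warm starts with `s ≲ log T / √T`: the initial point already has excess at most `2 s`, and tiny
  steps do not spoil it.
* Other warm starts: the gradient at the initial point has norm at most `s ≤ 1`, so by co-coercivity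
  the second moment of the stochastic gradient at any point is `O(s)` plus `4 κ` times the excess
  (`norm_lossGrad_sq_le_of_warm`). With `c = 1 / √s` the error after `T' ≥ s T` iterates is of order
  `√s log T / √T' ≤ log T / √T`, and `s ≳ log T / √T` is what makes the steps short enough
  to absorb the excess term.

A reused explanation costs an additional `O(log T / √T)`, since the loss is Lipschitz in the query
(`loss_le_loss_add`). In the regime `T = √m` the quantity `√n σ_min` is bounded
(`sqrt_mul_sigmaMin_le`), which reduces the second claim to the first.
-/

noncomputable section

namespace AdaptiveDP

/-! ### The weight function and the local loss -/

/-- On the nonnegative half-line the two branches of the weight combine into one formula, because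
the threshold `(√(2κ+1) - 1)/2` is the positive solution of `2 t (1 + t) = κ`. -/
theorem weight_eq {κ : ℝ} (hκ : 0 < κ) {t : ℝ} (ht : 0 ≤ t) :
    weight κ t = (max 1 (2 * t * (1 + t) / κ))⁻¹ := by
  have h : t ≤ (√(2 * κ + 1) - 1) / 2 ↔ 2 * t * (1 + t) ≤ κ := by
    have : t ≤ (√(2 * κ + 1) - 1) / 2 ↔ 2 * t + 1 ≤ √(2 * κ + 1) := by
      constructor <;> intro <;> linarith
    rw [this, Real.le_sqrt' (by linarith)]
    constructor <;> intro <;> nlinarith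
  unfold weight
  split_ifs with h1
  · rw [max_eq_left, inv_one]
    rw [div_le_one hκ]; exact h.1 h1
  · rw [max_eq_right, inv_div]
    rw [one_le_div hκ]; rw [h] at h1; linarith

theorem weight_pos {κ : ℝ} (hκ : 0 < κ) {t : ℝ} (ht : 0 ≤ t) : 0 < weight κ t := by
  rw [weight_eq hκ ht]; positivity

theorem weight_le_one {κ : ℝ} (hκ : 0 < κ) {t : ℝ} (ht : 0 ≤ t) : weight κ t ≤ 1 := by
  rw [weight_eq hκ ht]; exact inv_le_one_of_one_le₀ (le_max_left _ _)

theorem weight_mul_le {κ : ℝ} (hκ : 0 < κ) {t : ℝ} (ht : 0 ≤ t) :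
    weight κ t * (t * (1 + t)) ≤ κ / 2 := by
  rw [weight_eq hκ ht, inv_mul_le_iff₀ (by positivity)]
  have : 2 * t * (1 + t) / κ * (κ / 2) = t * (1 + t) := by field_simp
  rw [← this]
  exact mul_le_mul_of_nonneg_right (le_max_right _ _) (by positivity)

theorem weight_mul_self_le {κ : ℝ} (hκ : 0 < κ) {t : ℝ} (ht : 0 ≤ t) :
    weight κ t * t ≤ κ / 2 := by
  have := weight_mul_le hκ ht
  have := mul_nonneg (weight_pos hκ ht).le (mul_self_nonneg t)
  nlinarith

theorem weight_mul_sq_le {κ : ℝ} (hκ : 0 < κ) {t : ℝ} (ht : 0 ≤ t) :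
    weight κ t * t ^ 2 ≤ κ / 2 := by
  have := weight_mul_le hκ ht
  have := mul_nonneg (weight_pos hκ ht).le ht
  nlinarith

theorem weight_mul_one_add_sq_le {κ : ℝ} (hκ : 0 < κ) {t : ℝ} (ht : 0 ≤ t) :
    weight κ t * (1 + t) ^ 2 ≤ 1 + κ := by
  have := weight_mul_le hκ ht
  have := weight_mul_self_le hκ ht
  have := weight_le_one hκ ht
  nlinarith

theorem weight_antitone {κ : ℝ} (hκ : 0 < κ) {t u : ℝ} (ht : 0 ≤ t) (htu : t ≤ u) :
    weight κ u ≤ weight κ t := by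
  rw [weight_eq hκ ht, weight_eq hκ (ht.trans htu)]
  have : 0 ≤ u := ht.trans htu
  gcongr

/-- The weight decreases so slowly that its decrements are `O(u - t)` even after multiplication by
`(1 + t) ^ 2`, the bound on the squared residual at distance `t`. -/
theorem weight_sub_mul_le {κ : ℝ} (hκ : 0 < κ) {t u : ℝ} (ht : 0 ≤ t) (htu : t ≤ u) :
    (weight κ t - weight κ u) * (1 + t) ^ 2 ≤ 4 * (1 + κ) ^ 2 / κ * (u - t) := by
  have hu : 0 ≤ u := ht.trans htu
  have h1 : weight κ t - weight κ u ≤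
      weight κ t * weight κ u * (2 * u * (1 + u) / κ - 2 * t * (1 + t) / κ) := by
    rw [weight_eq hκ ht, weight_eq hκ hu]
    set p := 2 * t * (1 + t) / κ
    set q := 2 * u * (1 + u) / κ
    have hpq : p ≤ q := by simp only [p, q]; gcongr
    have e : (max 1 p)⁻¹ - (max 1 q)⁻¹ = (max 1 p)⁻¹ * (max 1 q)⁻¹ * (max 1 q - max 1 p) := by
      field_simp
    rw [e]
    refine mul_le_mul_of_nonneg_left ?_ (by positivity)
    rcases le_total 1 p with h | h <;> rcases le_total 1 q with h' | h' <;>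
      simp only [max_eq_left, max_eq_right, h, h'] <;> linarith
  have h2 : 2 * u * (1 + u) / κ - 2 * t * (1 + t) / κ = 2 * (1 + t + u) / κ * (u - t) := by
    field_simp; ring
  have h3 := weight_mul_one_add_sq_le hκ ht
  have h4 : weight κ u * (1 + t + u) ≤ 2 * (1 + κ) := by
    have := weight_mul_self_le hκ hu
    have := weight_le_one hκ hu
    have : weight κ u * t ≤ weight κ u * u :=
      mul_le_mul_of_nonneg_left htu (weight_pos hκ hu).le
    nlinarith
  have h5 : weight κ t * (1 + t) ^ 2 * (weight κ u * (1 + t + u)) ≤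
      (1 + κ) * (2 * (1 + κ)) :=
    mul_le_mul h3 h4 (mul_nonneg (weight_pos hκ hu).le (by linarith)) (by linarith)
  calc (weight κ t - weight κ u) * (1 + t) ^ 2
      ≤ weight κ t * weight κ u * (2 * (1 + t + u) / κ * (u - t)) * (1 + t) ^ 2 := by
        rw [h2] at h1; gcongr
    _ = weight κ t * (1 + t) ^ 2 * (weight κ u * (1 + t + u)) * (2 / κ * (u - t)) := by ring
    _ ≤ (1 + κ) * (2 * (1 + κ)) * (2 / κ * (u - t)) := by
        have : 0 ≤ u - t := by linarith
        gcongr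
    _ = _ := by ring

section Loss

variable {κ : ℝ} {n m : ℕ} {x : Fin m → Pt n} {f : Pt n → ℝ} {z : Pt n}

/-- The quadratic part of the loss. -/
def lossQuad (κ : ℝ) (x : Fin m → Pt n) (z u : Pt n) : ℝ :=
  (1 / (m : ℝ)) * ∑ i, weight κ ‖x i - z‖ * (inner ℝ u (x i - z)) ^ 2

/-- An average over the data points is bounded by any common bound of its terms; the bound has to
be nonnegative because the average over the empty data set is `0`. -/
theorem average_le {a : Fin m → ℝ} {b : ℝ} (hb : 0 ≤ b) (h : ∀ i, a i ≤ b) :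
    (1 / (m : ℝ)) * ∑ i, a i ≤ b := by
  rcases Nat.eq_zero_or_pos m with rfl | hm
  · simpa using hb
  · have hm' : (0 : ℝ) < m := by exact_mod_cast hm
    rw [one_div, inv_mul_le_iff₀ hm']
    simpa using Finset.sum_le_sum (fun i (_ : i ∈ Finset.univ) => h i)

theorem lossQuad_nonneg (hκ : 0 < κ) (u : Pt n) : 0 ≤ lossQuad κ x z u :=
  mul_nonneg (by positivity)
    (Finset.sum_nonneg fun i _ => mul_nonneg (weight_pos hκ (norm_nonneg _)).le (sq_nonneg _))

theorem lossQuad_le (hκ : 0 < κ) (u : Pt n) : lossQuad κ x z u ≤ κ / 2 * ‖u‖ ^ 2 := by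
  refine average_le (by positivity) fun i => ?_
  have h1 : (inner ℝ u (x i - z)) ^ 2 ≤ (‖u‖ * ‖x i - z‖) ^ 2 := by
    rw [← sq_abs]
    exact pow_le_pow_left₀ (abs_nonneg _) (abs_real_inner_le_norm _ _) 2
  have h2 := weight_mul_sq_le hκ (norm_nonneg (x i - z))
  calc weight κ ‖x i - z‖ * (inner ℝ u (x i - z)) ^ 2
      ≤ weight κ ‖x i - z‖ * (‖u‖ * ‖x i - z‖) ^ 2 :=
        mul_le_mul_of_nonneg_left h1 (weight_pos hκ (norm_nonneg _)).le
    _ = (weight κ ‖x i - z‖ * ‖x i - z‖ ^ 2) * ‖u‖ ^ 2 := by ring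
    _ ≤ _ := by gcongr

theorem loss_expand_aux (φ ψ : Pt n) :
    loss κ x f z φ = loss κ x f z ψ +
      inner ℝ ((2 / (m : ℝ)) • ∑ i, (weight κ ‖x i - z‖ *
        (inner ℝ ψ (x i - z) - f (x i))) • (x i - z)) (φ - ψ) + lossQuad κ x z (φ - ψ) := by
  unfold loss lossQuad
  rw [real_inner_smul_left, sum_inner, Finset.mul_sum, Finset.mul_sum, Finset.mul_sum,
    Finset.mul_sum, ← Finset.sum_add_distrib, ← Finset.sum_add_distrib]
  refine Finset.sum_congr rfl fun i _ => ?_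
  rw [real_inner_smul_left, real_inner_comm (φ - ψ) (x i - z), inner_sub_left]
  ring

theorem lossGrad_eq (hκ : 0 < κ) (ψ : Pt n) :
    lossGrad κ x f z ψ = (2 / (m : ℝ)) • ∑ i, (weight κ ‖x i - z‖ *
        (inner ℝ ψ (x i - z) - f (x i))) • (x i - z) := by
  refine HasGradientAt.gradient ?_
  rw [hasGradientAt_iff_isLittleO]
  have h : (fun φ => lossQuad κ x z (φ - ψ)) =O[nhds ψ] fun φ => ‖φ - ψ‖ ^ 2 := by
    refine Asymptotics.IsBigO.of_bound (κ / 2) (Filter.Eventually.of_forall fun φ => ?_)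
    rw [Real.norm_eq_abs, abs_of_nonneg (lossQuad_nonneg hκ _), Real.norm_eq_abs,
      abs_of_nonneg (by positivity)]
    exact lossQuad_le hκ _
  have h2 : (fun φ : Pt n => ‖φ - ψ‖ ^ 2) =o[nhds ψ] fun φ => φ - ψ := by
    have := Asymptotics.isLittleO_pow_sub_sub ψ (m := 2) (by norm_num)
    exact this
  refine (h.trans_isLittleO h2).congr_left fun φ => ?_
  rw [loss_expand_aux (κ := κ) (f := f) φ ψ]
  ring

/-- The loss is a quadratic polynomial, hence equals its second order Taylor expansion. -/
theorem loss_expand (hκ : 0 < κ) (φ ψ : Pt n) :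
    loss κ x f z φ = loss κ x f z ψ + inner ℝ (lossGrad κ x f z ψ) (φ - ψ) +
      lossQuad κ x z (φ - ψ) := by
  rw [lossGrad_eq hκ]; exact loss_expand_aux φ ψ

theorem loss_sub_le_inner (hκ : 0 < κ) (φ ψ : Pt n) :
    loss κ x f z φ - loss κ x f z ψ ≤ inner ℝ (lossGrad κ x f z φ) (φ - ψ) := by
  have h := loss_expand (x := x) (f := f) (z := z) hκ ψ φ
  have h2 := lossQuad_nonneg (x := x) (z := z) hκ (ψ - φ)
  rw [← neg_sub φ ψ, inner_neg_right] at h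
  rw [neg_sub] at h
  linarith

theorem continuous_loss : Continuous (loss κ x f z) := by unfold loss; fun_prop

theorem continuous_lossGrad (hκ : 0 < κ) : Continuous (lossGrad κ x f z) := by
  rw [funext (lossGrad_eq hκ)]; fun_prop

theorem loss_nonneg (hκ : 0 < κ) (φ : Pt n) : 0 ≤ loss κ x f z φ :=
  mul_nonneg (by positivity)
    (Finset.sum_nonneg fun i _ => mul_nonneg (weight_pos hκ (norm_nonneg _)).le (sq_nonneg _))

theorem abs_residual_le (hf : ∀ i, |f (x i)| ≤ 1) {φ : Pt n} (hφ : ‖φ‖ ≤ 1) (i : Fin m) (w : Pt n) :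
    |inner ℝ φ w - f (x i)| ≤ 1 + ‖w‖ := by
  have h1 := abs_real_inner_le_norm φ w
  have h2 : ‖φ‖ * ‖w‖ ≤ ‖w‖ := mul_le_of_le_one_left (norm_nonneg _) hφ
  have h3 := abs_sub (inner ℝ φ w) (f (x i))
  linarith [hf i]

theorem loss_le (hκ : 0 < κ) (hf : ∀ i, |f (x i)| ≤ 1) {φ : Pt n} (hφ : ‖φ‖ ≤ 1) :
    loss κ x f z φ ≤ 1 + κ := by
  refine average_le (by positivity) fun i => ?_
  refine le_trans (mul_le_mul_of_nonneg_left ?_ (weight_pos hκ (norm_nonneg _)).le)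
    (weight_mul_one_add_sq_le hκ (norm_nonneg (x i - z)))
  rw [← sq_abs]
  exact pow_le_pow_left₀ (abs_nonneg _) (abs_residual_le hf hφ i _) 2

theorem norm_lossGrad_le (hκ : 0 < κ) (hf : ∀ i, |f (x i)| ≤ 1) {φ : Pt n} (hφ : ‖φ‖ ≤ 1) :
    ‖lossGrad κ x f z φ‖ ≤ κ := by
  rw [lossGrad_eq hκ, norm_smul, Real.norm_eq_abs, abs_of_nonneg (by positivity)]
  have h : (1 / (m : ℝ)) * ∑ i, ‖(weight κ ‖x i - z‖ *
      (inner ℝ φ (x i - z) - f (x i))) • (x i - z)‖ ≤ κ / 2 := by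
    refine average_le (by positivity) fun i => ?_
    have hw := weight_pos hκ (norm_nonneg (x i - z))
    rw [norm_smul, norm_mul, Real.norm_eq_abs, Real.norm_eq_abs, abs_of_pos hw]
    calc _ ≤ weight κ ‖x i - z‖ * (1 + ‖x i - z‖) * ‖x i - z‖ := by
          gcongr; exact abs_residual_le hf hφ i _
      _ = weight κ ‖x i - z‖ * (‖x i - z‖ * (1 + ‖x i - z‖)) := by ring
      _ ≤ _ := weight_mul_le hκ (norm_nonneg _)
  calc 2 / (m : ℝ) * _ ≤ 2 / (m : ℝ) * ∑ i, ‖(weight κ ‖x i - z‖ *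
      (inner ℝ φ (x i - z) - f (x i))) • (x i - z)‖ := by gcongr; exact norm_sum_le _ _
    _ = 2 * ((1 / (m : ℝ)) * ∑ i, ‖(weight κ ‖x i - z‖ *
      (inner ℝ φ (x i - z) - f (x i))) • (x i - z)‖) := by ring
    _ ≤ κ := by linarith

/-- Co-coercivity of the gradient: its increments are controlled by the Bregman divergence of the
loss, with smoothness constant `κ`. -/
theorem norm_lossGrad_sub_sq_le (hκ : 0 < κ) (φ ψ : Pt n) :
    ‖lossGrad κ x f z φ - lossGrad κ x f z ψ‖ ^ 2 ≤ 2 * κ * lossQuad κ x z (φ - ψ) := by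
  have hw : ∀ i, 0 ≤ weight κ ‖x i - z‖ := fun i => (weight_pos hκ (norm_nonneg _)).le
  have h1 : lossGrad κ x f z φ - lossGrad κ x f z ψ = (2 / (m : ℝ)) • ∑ i, (weight κ ‖x i - z‖ *
        inner ℝ (φ - ψ) (x i - z)) • (x i - z) := by
    rw [lossGrad_eq hκ, lossGrad_eq hκ, ← smul_sub, ← Finset.sum_sub_distrib]
    congr 1
    refine Finset.sum_congr rfl fun i _ => ?_
    rw [← sub_smul, inner_sub_left]; congr 1; ring
  have h2 : ‖∑ i, (weight κ ‖x i - z‖ * inner ℝ (φ - ψ) (x i - z)) • (x i - z)‖ ≤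
      ∑ i, (√(weight κ ‖x i - z‖) * |inner ℝ (φ - ψ) (x i - z)|) *
        (√(weight κ ‖x i - z‖) * ‖x i - z‖) := by
    refine (norm_sum_le _ _).trans (Finset.sum_le_sum fun i _ => le_of_eq ?_)
    rw [norm_smul, norm_mul, Real.norm_eq_abs, Real.norm_eq_abs, abs_of_nonneg (hw i)]
    nth_rewrite 1 [← Real.mul_self_sqrt (hw i)]
    ring
  have h3 := Finset.sum_mul_sq_le_sq_mul_sq Finset.univ
    (fun i => √(weight κ ‖x i - z‖) * |inner ℝ (φ - ψ) (x i - z)|)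
    (fun i => √(weight κ ‖x i - z‖) * ‖x i - z‖)
  simp only [mul_pow, Real.sq_sqrt (hw _), sq_abs] at h3
  have h4 : (1 / (m : ℝ)) * ∑ i, weight κ ‖x i - z‖ * ‖x i - z‖ ^ 2 ≤ κ / 2 :=
    average_le (by positivity) fun i => weight_mul_sq_le hκ (norm_nonneg _)
  have hq := lossQuad_nonneg (x := x) (z := z) hκ (φ - ψ)
  rw [h1, norm_smul, Real.norm_eq_abs, abs_of_nonneg (by positivity), mul_pow]
  calc (2 / (m : ℝ)) ^ 2 * _ ^ 2 ≤ (2 / (m : ℝ)) ^ 2 *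
        ((∑ i, weight κ ‖x i - z‖ * inner ℝ (φ - ψ) (x i - z) ^ 2) *
          ∑ i, weight κ ‖x i - z‖ * ‖x i - z‖ ^ 2) := by
        gcongr
        exact (pow_le_pow_left₀ (norm_nonneg _) h2 2).trans h3
    _ = 4 * lossQuad κ x z (φ - ψ) *
        ((1 / (m : ℝ)) * ∑ i, weight κ ‖x i - z‖ * ‖x i - z‖ ^ 2) := by
        unfold lossQuad; ring
    _ ≤ 4 * lossQuad κ x z (φ - ψ) * (κ / 2) := by gcongr
    _ = _ := by ring

/-- First order optimality of a minimizer over the unit ball. -/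
theorem inner_lossGrad_nonneg (hκ : 0 < κ) {ψ : Pt n} (hψ : ‖ψ‖ ≤ 1)
    (hmin : ∀ φ ∈ Metric.closedBall (0 : Pt n) 1, loss κ x f z ψ ≤ loss κ x f z φ)
    {φ : Pt n} (hφ : ‖φ‖ ≤ 1) : 0 ≤ inner ℝ (lossGrad κ x f z ψ) (φ - ψ) := by
  have key : ∀ t : ℝ, 0 < t → t ≤ 1 →
      0 ≤ inner ℝ (lossGrad κ x f z ψ) (φ - ψ) + t * lossQuad κ x z (φ - ψ) := by
    intro t ht ht1
    have hmem : ψ + t • (φ - ψ) ∈ Metric.closedBall (0 : Pt n) 1 :=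
      (convex_closedBall (0 : Pt n) 1).add_smul_sub_mem (by simpa using hψ) (by simpa using hφ)
        ⟨ht.le, ht1⟩
    have h1 := hmin _ hmem
    rw [loss_expand hκ (ψ + t • (φ - ψ)) ψ, add_sub_cancel_left, real_inner_smul_right] at h1
    have h2 : lossQuad κ x z (t • (φ - ψ)) = t ^ 2 * lossQuad κ x z (φ - ψ) := by
      unfold lossQuad
      simp only [real_inner_smul_left, Finset.mul_sum]
      refine Finset.sum_congr rfl fun i _ => ?_
      ring
    rw [h2] at h1
    have h3 : 0 ≤ t * (inner ℝ (lossGrad κ x f z ψ) (φ - ψ) + t * lossQuad κ x z (φ - ψ)) := by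
      linarith
    exact nonneg_of_mul_nonneg_right h3 ht
  have hlim : Filter.Tendsto
      (fun t : ℝ => inner ℝ (lossGrad κ x f z ψ) (φ - ψ) + t * lossQuad κ x z (φ - ψ))
      (nhdsWithin 0 (Set.Ioi 0)) (nhds (inner ℝ (lossGrad κ x f z ψ) (φ - ψ))) := by
    have : Continuous fun t : ℝ =>
      inner ℝ (lossGrad κ x f z ψ) (φ - ψ) + t * lossQuad κ x z (φ - ψ) := by fun_prop
    simpa using this.tendsto 0 |>.mono_left nhdsWithin_le_nhds
  refine ge_of_tendsto hlim ?_
  filter_upwards [Ioo_mem_nhdsGT (show (0 : ℝ) < 1 by norm_num)] with t ht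
  exact key t ht.1 ht.2.le

/-- The loss of one data point is Lipschitz in the displacement; the reuse of explanations of
nearby queries rests on this. -/
theorem weighted_residual_lipschitz (hκ : 0 < κ) {φ : Pt n} (hφ : ‖φ‖ ≤ 1) {y : ℝ} (hy : |y| ≤ 1)
    (v w : Pt n) :
    weight κ ‖v‖ * (inner ℝ φ v - y) ^ 2 ≤ weight κ ‖w‖ * (inner ℝ φ w - y) ^ 2 +
      (4 * (1 + κ) ^ 2 / κ + 2 * (1 + κ)) * ‖v - w‖ := by
  have hres : ∀ u : Pt n, |inner ℝ φ u - y| ≤ 1 + ‖u‖ := fun u => by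
    have h1 := abs_real_inner_le_norm φ u
    have h2 : ‖φ‖ * ‖u‖ ≤ ‖u‖ := mul_le_of_le_one_left (norm_nonneg _) hφ
    have h3 := abs_sub (inner ℝ φ u) y
    linarith
  have hdiff : |(inner ℝ φ v - y) - (inner ℝ φ w - y)| ≤ ‖v - w‖ := by
    rw [sub_sub_sub_cancel_right, ← inner_sub_right]
    exact (abs_real_inner_le_norm _ _).trans (mul_le_of_le_one_left (norm_nonneg _) hφ)
  have hn : |‖v‖ - ‖w‖| ≤ ‖v - w‖ := abs_norm_sub_norm_le v w
  have hv := hres v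
  have hw := hres w
  set a := inner ℝ φ v - y
  set b := inner ℝ φ w - y
  set D := ‖v - w‖
  have hD : 0 ≤ D := norm_nonneg _
  have hc : 0 ≤ 4 * (1 + κ) ^ 2 / κ := by positivity
  -- the difference of the squares, at the larger of the two radii
  have hsq : ∀ t : ℝ, 0 ≤ t → ‖v‖ ≤ t → ‖w‖ ≤ t →
      weight κ t * (a ^ 2 - b ^ 2) ≤ 2 * (1 + κ) * D := by
    intro t ht h1 h2
    have h3 : a ^ 2 - b ^ 2 ≤ D * (2 * (1 + t)) := by
      rw [sq_sub_sq, mul_comm]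
      refine (le_abs_self _).trans ?_
      rw [abs_mul]
      refine mul_le_mul hdiff ((abs_add_le _ _).trans (by linarith)) (abs_nonneg _) hD
    have h4 : weight κ t * (1 + t) ≤ 1 + κ := by
      have := weight_mul_self_le hκ ht
      have := weight_le_one hκ ht
      nlinarith
    calc weight κ t * (a ^ 2 - b ^ 2) ≤ weight κ t * (D * (2 * (1 + t))) :=
          mul_le_mul_of_nonneg_left h3 (weight_pos hκ ht).le
      _ = 2 * (weight κ t * (1 + t)) * D := by ring
      _ ≤ _ := by gcongr
  rcases le_total ‖v‖ ‖w‖ with h | h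
  · have h1 := hsq ‖w‖ (norm_nonneg _) h le_rfl
    have h2 := weight_sub_mul_le hκ (norm_nonneg v) h
    have h3 : a ^ 2 ≤ (1 + ‖v‖) ^ 2 := by
      rw [← sq_abs]; exact pow_le_pow_left₀ (abs_nonneg _) hv 2
    have h4 := mul_le_mul_of_nonneg_left h3
      (sub_nonneg.2 (weight_antitone hκ (norm_nonneg v) h))
    have h5 : 4 * (1 + κ) ^ 2 / κ * (‖w‖ - ‖v‖) ≤ 4 * (1 + κ) ^ 2 / κ * D := by
      gcongr; linarith [neg_abs_le (‖v‖ - ‖w‖)]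
    nlinarith
  · have h1 := hsq ‖v‖ (norm_nonneg _) le_rfl h
    have h2 := mul_le_mul_of_nonneg_right (weight_antitone hκ (norm_nonneg w) h) (sq_nonneg b)
    have h3 := mul_nonneg hc hD
    nlinarith

/-- The Lipschitz constant of the loss in the query point. -/
def queryLip (κ : ℝ) : ℝ := 4 * (1 + κ) ^ 2 / κ + 2 * (1 + κ)

theorem queryLip_nonneg (hκ : 0 < κ) : 0 ≤ queryLip κ := by unfold queryLip; positivity

theorem loss_le_loss_add (hκ : 0 < κ) (hf : ∀ i, |f (x i)| ≤ 1) {φ : Pt n} (hφ : ‖φ‖ ≤ 1)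
    (z z' : Pt n) : loss κ x f z φ ≤ loss κ x f z' φ + queryLip κ * ‖z - z'‖ := by
  have h := average_le (m := m) (b := queryLip κ * ‖z - z'‖)
    (a := fun i => weight κ ‖x i - z‖ * (inner ℝ φ (x i - z) - f (x i)) ^ 2 -
      weight κ ‖x i - z'‖ * (inner ℝ φ (x i - z') - f (x i)) ^ 2)
    (mul_nonneg (queryLip_nonneg hκ) (norm_nonneg _)) fun i => by
      have := weighted_residual_lipschitz hκ hφ (hf i) (x i - z) (x i - z')
      rw [sub_sub_sub_cancel_left, norm_sub_rev z' z] at this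
      unfold queryLip; linarith
  rw [Finset.sum_sub_distrib, mul_sub] at h
  unfold loss; linarith

theorem optLoss_le {φ : Pt n} (hφ : ‖φ‖ ≤ 1) : optLoss κ x f z ≤ loss κ x f z φ := by
  obtain ⟨ψ, -, h1, h2⟩ := exists_optimal κ x f z
  rw [← h1]; exact h2 φ (by simpa using hφ)

theorem optLoss_nonneg (hκ : 0 < κ) : 0 ≤ optLoss κ x f z := by
  obtain ⟨ψ, -, h1, -⟩ := exists_optimal κ x f z
  rw [← h1]; exact loss_nonneg hκ _

theorem optLoss_le_optLoss_add (hκ : 0 < κ) (hf : ∀ i, |f (x i)| ≤ 1) (z z' : Pt n) :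
    optLoss κ x f z ≤ optLoss κ x f z' + queryLip κ * ‖z - z'‖ := by
  obtain ⟨ψ, hψ, h1, -⟩ := exists_optimal κ x f z'
  have hψ : ‖ψ‖ ≤ 1 := by simpa using hψ
  rw [← h1]
  exact (optLoss_le hψ).trans (loss_le_loss_add hκ hf hψ z z')

end Loss

/-! ### The last iterate of a scheme with step sizes `c / √t` -/

/-- From suffix averages to the last term. Read `a k` as the error of the `k`-th iterate counted
from the end. If comparing the last `i + 1` iterates with the first one among them costs at most
`Q` per step, up to a fraction `θ` of their total error, then dropping that iterate changes the
average of the others by `O(1 / i)` only, and the changes add up to a harmonic sum. -/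
theorem last_le_suffix_average {a : ℕ → ℝ} (ha : ∀ k, 0 ≤ a k) {θ Q : ℝ} (hθ : 0 ≤ θ) (hQ : 0 ≤ Q)
    {M : ℕ} (h : ∀ i ≤ M, ∑ k ∈ Finset.range (i + 1), (a k - a i) ≤
      (i + 1) * Q + θ * ∑ k ∈ Finset.range (i + 1), a k) :
    a 0 ≤ Real.exp (θ * ∑ k ∈ Finset.range M, 1 / ((k : ℝ) + 1)) *
      ((∑ k ∈ Finset.range (M + 1), a k) / (M + 1) +
        Q * ∑ k ∈ Finset.range M, 1 / ((k : ℝ) + 1)) := by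
  have key : ∀ i ≤ M, a 0 ≤ Real.exp (θ * ∑ k ∈ Finset.range i, 1 / ((k : ℝ) + 1)) *
      ((∑ k ∈ Finset.range (i + 1), a k) / (i + 1) +
        Q * ∑ k ∈ Finset.range i, 1 / ((k : ℝ) + 1)) := by
    intro i
    induction i with
    | zero => simp
    | succ i ih =>
      intro hi
      refine (ih (by omega)).trans ?_
      have h1 := h (i + 1) hi
      rw [Finset.sum_sub_distrib, Finset.sum_const, Finset.card_range, nsmul_eq_mul,
        Finset.sum_range_succ a (i + 1)] at h1
      rw [Finset.sum_range_succ a (i + 1), Finset.sum_range_succ (fun k : ℕ => 1 / ((k : ℝ) + 1)) i]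
      set P := ∑ k ∈ Finset.range (i + 1), a k
      set H := ∑ k ∈ Finset.range i, 1 / ((k : ℝ) + 1)
      set y := a (i + 1)
      have hP : 0 ≤ P := Finset.sum_nonneg fun k _ => ha k
      have hH : 0 ≤ H := Finset.sum_nonneg fun k _ => by positivity
      have hy : 0 ≤ y := ha _
      push_cast at h1 ⊢
      have hi0 : (0 : ℝ) < (i : ℝ) + 1 := by positivity
      have hrec : P / ((i : ℝ) + 1) ≤ (1 + θ / ((i : ℝ) + 1)) * ((P + y) / ((i : ℝ) + 1 + 1)) +
          Q / ((i : ℝ) + 1) := by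
        have e : (1 + θ / ((i : ℝ) + 1)) * ((P + y) / ((i : ℝ) + 1 + 1)) + Q / ((i : ℝ) + 1) =
            (((i : ℝ) + 1 + θ) * (P + y) + ((i : ℝ) + 1 + 1) * Q) / ((i : ℝ) + 1 + 1) /
              ((i : ℝ) + 1) := by
          field_simp
        rw [e]
        gcongr
        rw [le_div_iff₀ (by positivity)]
        nlinarith
      have hexp : 1 + θ / ((i : ℝ) + 1) ≤ Real.exp (θ * (1 / ((i : ℝ) + 1))) := by
        have := Real.add_one_le_exp (θ * (1 / ((i : ℝ) + 1)))
        rw [mul_one_div] at this ⊢; linarith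
      have hS : 0 ≤ (P + y) / ((i : ℝ) + 1 + 1) := by positivity
      have h1e : 1 ≤ Real.exp (θ * (1 / ((i : ℝ) + 1))) := Real.one_le_exp (by positivity)
      rw [mul_add θ, Real.exp_add, mul_assoc]
      refine mul_le_mul_of_nonneg_left ?_ (Real.exp_pos _).le
      calc P / ((i : ℝ) + 1) + Q * H
          ≤ (1 + θ / ((i : ℝ) + 1)) * ((P + y) / ((i : ℝ) + 1 + 1)) + 1 * (Q / ((i : ℝ) + 1) +
            Q * H) := by linarith
        _ ≤ Real.exp (θ * (1 / ((i : ℝ) + 1))) * ((P + y) / ((i : ℝ) + 1 + 1)) +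
            Real.exp (θ * (1 / ((i : ℝ) + 1))) * (Q / ((i : ℝ) + 1) + Q * H) := by
            gcongr
        _ = _ := by ring
  exact key M le_rfl

theorem sum_range_one_div_le_log (M : ℕ) :
    ∑ k ∈ Finset.range M, 1 / ((k : ℝ) + 1) ≤ 1 + Real.log M := by
  have h := harmonic_le_one_add_log M
  simpa [harmonic] using h

/-- Summation by parts for squared distances `d k`, bounded by the square of the diameter `2` of
the unit ball. -/
theorem sum_sub_mul_sqrt_le {d : ℕ → ℝ} (hd : ∀ k, d k ≤ 4) (j i : ℕ) :
    ∑ k ∈ Finset.range (i + 1), (d (j + k) - d (j + k + 1)) * √((j + k : ℕ) + 1) ≤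
      d j * √((j : ℝ) + 1) + 4 * (√((j + i : ℕ) + 1) - √((j : ℝ) + 1)) -
        d (j + i + 1) * √((j + i : ℕ) + 1) := by
  induction i with
  | zero => simp [sub_mul]
  | succ i ih =>
    rw [Finset.sum_range_succ]
    have h1 : √((j + i : ℕ) + 1 : ℝ) ≤ √((j + (i + 1) : ℕ) + 1) :=
      Real.sqrt_le_sqrt (by push_cast; linarith)
    have h2 := mul_le_mul_of_nonneg_right (hd (j + i + 1)) (sub_nonneg.2 h1)
    have e : j + (i + 1) = j + i + 1 := by ring
    rw [e] at h1 h2 ⊢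
    nlinarith

/-- Regret over the iterates `j, …, j + i` against a comparator with value `v`, in the second half
of the run, where all step sizes are comparable. -/
theorem regret_le {c B b v : ℝ} (hc : 0 < c) (hB : 0 ≤ B) (hb : 0 ≤ b) {e d : ℕ → ℝ}
    (he : ∀ k, 0 ≤ e k) (hd0 : ∀ k, 0 ≤ d k) (hd : ∀ k, d k ≤ 4) {j i : ℕ}
    (hij : j + i + 1 ≤ 2 * (j + 1))
    (h : ∀ k : ℕ, j ≤ k → 2 * (c / √((k : ℝ) + 1)) * (e k - v) ≤
      d k - d (k + 1) + (c / √((k : ℝ) + 1)) ^ 2 * (B + b * e k)) :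
    ∑ k ∈ Finset.range (i + 1), (e (j + k) - v) ≤
      (d j * √((j : ℝ) + 1) + 4 * (√((j + i : ℕ) + 1) - √((j : ℝ) + 1))) / (2 * c) +
      c / √((j + i : ℕ) + 1) * ((i + 1) * B + b * ∑ k ∈ Finset.range (i + 1), e (j + k)) := by
  have hk : ∀ k ∈ Finset.range (i + 1), e (j + k) - v ≤
      (d (j + k) - d (j + k + 1)) * √((j + k : ℕ) + 1) / (2 * c) +
        c / √((j + i : ℕ) + 1) * (B + b * e (j + k)) := by
    intro k hk
    rw [Finset.mem_range] at hk
    have h1 := h (j + k) (by omega)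
    set r := √((j + k : ℕ) + 1 : ℝ) with hr
    have hr0 : 0 < r := Real.sqrt_pos.2 (by positivity)
    have hX : 0 ≤ B + b * e (j + k) := add_nonneg hB (mul_nonneg hb (he _))
    have h2 : e (j + k) - v ≤ (d (j + k) - d (j + k + 1)) * r / (2 * c) +
        c / (2 * r) * (B + b * e (j + k)) := by
      have h3 : 2 * (c / r) * ((d (j + k) - d (j + k + 1)) * r / (2 * c) +
        c / (2 * r) * (B + b * e (j + k))) =
          d (j + k) - d (j + k + 1) + (c / r) ^ 2 * (B + b * e (j + k)) := by
        field_simp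
      rw [← h3] at h1
      exact le_of_mul_le_mul_left h1 (by positivity)
    have h4 : √((j + i : ℕ) + 1 : ℝ) ≤ 2 * r := by
      rw [hr]
      have : (2 : ℝ) * √((j + k : ℕ) + 1 : ℝ) = √(4 * ((j + k : ℕ) + 1)) := by
        rw [Real.sqrt_mul (by norm_num), show (4 : ℝ) = 2 ^ 2 by norm_num,
          Real.sqrt_sq (by norm_num)]
      rw [this]
      apply Real.sqrt_le_sqrt
      have : (j + i + 1 : ℝ) ≤ 2 * (j + 1) := by exact_mod_cast hij
      push_cast
      have : (0 : ℝ) ≤ k := by positivity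
      have : (0 : ℝ) ≤ j := by positivity
      linarith
    have h5 : 0 < √((j + i : ℕ) + 1 : ℝ) := Real.sqrt_pos.2 (by positivity)
    have h6 : c / (2 * r) * (B + b * e (j + k)) ≤
        c / √((j + i : ℕ) + 1) * (B + b * e (j + k)) := by gcongr
    linarith
  refine (Finset.sum_le_sum hk).trans ?_
  rw [Finset.sum_add_distrib, ← Finset.sum_div, ← Finset.mul_sum, Finset.sum_add_distrib,
    ← Finset.mul_sum]
  simp only [Finset.sum_const, Finset.card_range, nsmul_eq_mul, Nat.cast_add, Nat.cast_one]
  gcongr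
  have := sum_sub_mul_sqrt_le hd j i
  have := mul_nonneg (hd0 (j + i + 1)) (Real.sqrt_nonneg ((j + i : ℕ) + 1 : ℝ))
  push_cast at *
  linarith

/-- Convergence of the last iterate: `e k` is the expected excess of iterate `k`, and `d j k`,
`D k` are expected squared distances of iterate `k` from iterate `j` and from the minimizer. The
second moment `B + b * e k` of the stochastic gradient may grow with the excess, as it does for
smooth objectives, provided the step sizes are small compared with `1 / (b log N)`. -/
theorem last_iterate_le {c B b : ℝ} (hc : 0 < c) (hB : 0 ≤ B) (hb : 0 ≤ b) {e D : ℕ → ℝ}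
    {d : ℕ → ℕ → ℝ} (he : ∀ k, 0 ≤ e k) (hd0 : ∀ j k, 0 ≤ d j k) (hd : ∀ j k, d j k ≤ 4)
    (hdd : ∀ j, d j j = 0) (hD0 : ∀ k, 0 ≤ D k) (hD : ∀ k, D k ≤ 4)
    (h1 : ∀ j k : ℕ, j ≤ k → 2 * (c / √((k : ℝ) + 1)) * (e k - e j) ≤
      d j k - d j (k + 1) + (c / √((k : ℝ) + 1)) ^ 2 * (B + b * e k))
    (h2 : ∀ k : ℕ, 2 * (c / √((k : ℝ) + 1)) * e k ≤
      D k - D (k + 1) + (c / √((k : ℝ) + 1)) ^ 2 * (B + b * e k)) (N : ℕ)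
    (hstep : b * (2 * c / √((N : ℝ) + 1)) * (1 + Real.log (N + 1)) ≤ 1) :
    e N ≤ 3 * (1 + Real.log (N + 1)) * (10 / c + 4 * c * B) / √((N : ℝ) + 1) := by
  set M := N / 2 with hM
  set R := √((N : ℝ) + 1) with hRdef
  have hR : 0 < R := Real.sqrt_pos.2 (by positivity)
  have hRR : R * R = N + 1 := Real.mul_self_sqrt (by positivity)
  set ℓ := 1 + Real.log (N + 1) with hℓ
  have hlog : 0 ≤ Real.log ((N : ℝ) + 1) :=
    Real.log_nonneg (by have : (0 : ℝ) ≤ N := by positivity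
                        linarith)
  have hℓ1 : 1 ≤ ℓ := by linarith
  have hbstep0 : 0 ≤ b * (2 * c / R) := by positivity
  have hbstep : b * (2 * c / R) ≤ 1 := (le_mul_of_one_le_right hbstep0 hℓ1).trans hstep
  let a : ℕ → ℝ := fun k => e (N - k)
  have ha : ∀ k, 0 ≤ a k := fun k => he _
  -- reversing a window
  have hrev : ∀ i ≤ M, ∀ v : ℝ, ∑ k ∈ Finset.range (i + 1), (e (N - i + k) - v) =
      ∑ k ∈ Finset.range (i + 1), (a k - v) := by
    intro i hi v
    rw [← Finset.sum_range_reflect]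
    refine Finset.sum_congr rfl fun k hk => ?_
    rw [Finset.mem_range] at hk
    simp only [a]
    congr 2
    omega
  have hrev0 : ∀ i ≤ M, ∑ k ∈ Finset.range (i + 1), e (N - i + k) =
      ∑ k ∈ Finset.range (i + 1), a k := by
    intro i hi
    simpa using hrev i hi 0
  have hcmp : ∀ i ≤ M, ∑ k ∈ Finset.range (i + 1), (a k - a i) ≤
      (i + 1) * (2 / (c * R) + c / R * B) +
        (b * (2 * c / R) / 2) * ∑ k ∈ Finset.range (i + 1), a k := by
    intro i hi
    have h := regret_le (v := e (N - i)) hc hB hb he (hd0 (N - i)) (hd (N - i)) (j := N - i)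
      (i := i) (by omega) (fun k hk => h1 _ k hk)
    rw [hrev i hi, hrev0 i hi, show N - i + i = N by omega, hdd] at h
    refine h.trans ?_
    have h3 : √(N + 1) - √(((N - i : ℕ) : ℝ) + 1) ≤ (i + 1) / R := by
      rw [le_div_iff₀ hR, sub_mul, hRR]
      have h4 : (((N - i : ℕ) : ℝ) + 1) ≤ √(((N - i : ℕ) : ℝ) + 1) * R := by
        nth_rewrite 1 [← Real.mul_self_sqrt (show 0 ≤ ((N - i : ℕ) : ℝ) + 1 by positivity)]
        exact mul_le_mul_of_nonneg_left (Real.sqrt_le_sqrt (by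
          have : ((N - i : ℕ) : ℝ) ≤ N := by exact_mod_cast Nat.sub_le _ _
          linarith)) (Real.sqrt_nonneg _)
      rw [Nat.cast_sub (by omega)] at h4 ⊢
      linarith
    have h5 : (0 * √(((N - i : ℕ) : ℝ) + 1) + 4 * (√(N + 1) - √(((N - i : ℕ) : ℝ) + 1))) / (2 * c)
        ≤ (0 + 4 * ((i + 1) / R)) / (2 * c) := by
      rw [zero_mul]; gcongr
    refine (add_le_add_left h5 _).trans (le_of_eq ?_)
    field_simp
    ring
  have hfull : (∑ k ∈ Finset.range (M + 1), a k) / (M + 1) ≤ 8 / (c * R) + 2 * c / R * B := by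
    have h := regret_le (v := 0) hc hB hb he hD0 hD (j := N - M) (i := M) (by omega)
      (fun k _ => by simpa using h2 k)
    rw [hrev M le_rfl, hrev0 M le_rfl, show N - M + M = N by omega] at h
    simp only [sub_zero] at h
    set P := ∑ k ∈ Finset.range (M + 1), a k
    have hP : 0 ≤ P := Finset.sum_nonneg fun k _ => ha k
    have h3 : (D (N - M) * √(((N - M : ℕ) : ℝ) + 1) + 4 * (√(N + 1) - √(((N - M : ℕ) : ℝ) + 1))) ≤
        4 * R := by
      have := mul_le_mul_of_nonneg_right (hD (N - M)) (Real.sqrt_nonneg (((N - M : ℕ) : ℝ) + 1))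
      linarith
    have h4 : P ≤ 4 * R / (2 * c) + c / R * ((M + 1) * B + b * P) :=
      h.trans (by gcongr)
    have h5 : c / R * (b * P) ≤ P / 2 := by
      calc c / R * (b * P) = (b * (2 * c / R)) * (P / 2) := by ring
        _ ≤ 1 * (P / 2) := by gcongr
        _ = P / 2 := one_mul _
    have h6 : P ≤ 4 * R / c + 2 * (c / R) * ((M + 1) * B) := by
      have : 4 * R / c = 2 * (4 * R / (2 * c)) := by field_simp
      rw [this]; nlinarith
    have hM2 : R * R ≤ 2 * ((M : ℝ) + 1) := by
      rw [hRR]; exact_mod_cast (by omega : N + 1 ≤ 2 * (M + 1))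
    rw [div_le_iff₀ (by positivity)]
    have h7 : 4 * R / c ≤ 8 / (c * R) * (M + 1) := by
      calc 4 * R / c = 4 * (R * R) / (c * R) := by field_simp
        _ ≤ 4 * (2 * ((M : ℝ) + 1)) / (c * R) := by gcongr
        _ = _ := by ring
    calc P ≤ 4 * R / c + 2 * (c / R) * ((M + 1) * B) := h6
      _ ≤ 8 / (c * R) * (M + 1) + 2 * (c / R) * ((M + 1) * B) := by gcongr
      _ = _ := by ring
  have hmain := last_le_suffix_average ha (θ := b * (2 * c / R) / 2)
    (Q := 2 / (c * R) + c / R * B) (by positivity) (by positivity) hcmp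
  have hH : ∑ k ∈ Finset.range M, 1 / ((k : ℝ) + 1) ≤ ℓ := by
    refine (sum_range_one_div_le_log M).trans ?_
    rcases Nat.eq_zero_or_pos M with h0 | h0
    · rw [h0]; simpa using hℓ1
    · rw [hℓ]
      have : (M : ℝ) ≤ N := by exact_mod_cast Nat.div_le_self N 2
      gcongr
      linarith
  have hH0 : 0 ≤ ∑ k ∈ Finset.range M, 1 / ((k : ℝ) + 1) :=
    Finset.sum_nonneg fun k _ => by positivity
  have hexp : Real.exp (b * (2 * c / R) / 2 * ∑ k ∈ Finset.range M, 1 / ((k : ℝ) + 1)) ≤ 3 := by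
    refine le_trans (Real.exp_le_exp.2 (?_ : _ ≤ (1 : ℝ)))
      (Real.exp_one_lt_d9.le.trans (by norm_num))
    calc _ ≤ b * (2 * c / R) * ℓ := by
          gcongr; linarith
      _ ≤ 1 := hstep
  calc e N = a 0 := by simp [a]
    _ ≤ _ := hmain
    _ ≤ 3 * ((8 / (c * R) + 2 * c / R * B) + (2 / (c * R) + c / R * B) * ℓ) := by
        have : 0 ≤ ∑ k ∈ Finset.range (M + 1), a k := Finset.sum_nonneg fun k _ => ha k
        gcongr
    _ ≤ 3 * ((8 / (c * R) + 2 * c / R * B) * ℓ + (2 / (c * R) + 2 * c / R * B) * ℓ) := by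
        have h8 : 8 / (c * R) + 2 * c / R * B ≤ (8 / (c * R) + 2 * c / R * B) * ℓ :=
          le_mul_of_one_le_right (by positivity) hℓ1
        have h9 : (2 / (c * R) + c / R * B) * ℓ ≤ (2 / (c * R) + 2 * c / R * B) * ℓ := by
          gcongr; linarith
        linarith
    _ = _ := by field_simp; ring

section NoisyDescent

/-! ### Gaussian noise -/

/-- The law of the Gaussian noise vectors of one run of gradient descent. -/
abbrev gaussianSeq (n : ℕ) : Measure (ℕ → Pt n) :=
  Measure.infinitePi fun _ : ℕ => stdGaussian (Pt n)

variable {n : ℕ}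

theorem integrable_norm_sq_stdGaussian :
    Integrable (fun x : Pt n => ‖x‖ ^ 2) (stdGaussian (Pt n)) :=
  (IsGaussian.memLp_two_id (μ := stdGaussian (Pt n))).integrable_norm_pow (by norm_num)

theorem integral_norm_sq_stdGaussian : ∫ x : Pt n, ‖x‖ ^ 2 ∂(stdGaussian (Pt n)) = n := by
  let b := EuclideanSpace.basisFun (Fin n) ℝ
  have h1 : ∀ x : Pt n, ‖x‖ ^ 2 = ∑ i, (innerSL ℝ (b i) x) ^ 2 := fun x => by
    rw [← b.sum_sq_inner_right x]; rfl
  have h2 : ∀ i, MemLp (fun x => innerSL ℝ (b i) x) 2 (stdGaussian (Pt n)) := fun i =>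
    (innerSL ℝ (b i)).comp_memLp' IsGaussian.memLp_two_id
  simp_rw [h1]
  rw [integral_finsetSum _ fun i _ => (h2 i).integrable_sq]
  have h3 : ∀ i, ∫ x : Pt n, (innerSL ℝ (b i) x) ^ 2 ∂(stdGaussian (Pt n)) = 1 := fun i => by
    rw [← variance_of_integral_eq_zero (h2 i).aemeasurable
      (integral_strongDual_stdGaussian (innerSL ℝ (b i))), variance_dual_stdGaussian]
    simp
  rw [Finset.sum_congr rfl fun i _ => h3 i]
  simp

theorem integrable_norm_sq_gaussianSeq (k : ℕ) :
    Integrable (fun Z : ℕ → Pt n => ‖Z k‖ ^ 2) (gaussianSeq n) :=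
  (measurePreserving_eval_infinitePi (fun _ : ℕ => stdGaussian (Pt n)) k).integrable_comp_of_integrable
    integrable_norm_sq_stdGaussian

theorem integral_norm_sq_gaussianSeq (k : ℕ) :
    ∫ Z : ℕ → Pt n, ‖Z k‖ ^ 2 ∂(gaussianSeq n) = n := by
  rw [← integral_norm_sq_stdGaussian,
    ← Measure.infinitePi_map_eval (fun _ : ℕ => stdGaussian (Pt n)) k, integral_map]
  · exact (measurable_pi_apply k).aemeasurable
  · exact Measurable.aestronglyMeasurable (by fun_prop)

/-- Reflection of the `k`-th noise vector. -/
def reflect (k : ℕ) (Z : ℕ → Pt n) (i : ℕ) : Pt n := if i = k then -Z i else Z i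

theorem map_reflect (k : ℕ) : (gaussianSeq n).map (reflect k) = gaussianSeq n := by
  have h : (reflect k : (ℕ → Pt n) → ℕ → Pt n) =
      fun Z i => (if i = k then fun v => -v else id : Pt n → Pt n) (Z i) := by
    ext Z i : 2
    unfold reflect
    split_ifs <;> rfl
  rw [h, Measure.infinitePi_map_pi]
  · congr 1
    funext i
    split_ifs
    · exact stdGaussian_map (LinearIsometryEquiv.neg ℝ (E := Pt n))
    · exact Measure.map_id
  · intro i
    split_ifs
    · exact measurable_neg
    · exact measurable_id

theorem measurable_reflect (k : ℕ) : Measurable (reflect k : (ℕ → Pt n) → ℕ → Pt n) := by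
  refine measurable_pi_lambda _ fun i => ?_
  unfold reflect
  split_ifs <;> fun_prop

/-- The noise of step `k` is centred given everything that does not depend on it. By symmetry, it
suffices that `X` does not change when the `k`-th noise vector is reflected. -/
theorem integral_inner_noise_eq_zero {X : (ℕ → Pt n) → Pt n} (hX : Measurable X) (k : ℕ)
    (h : ∀ Z, X (reflect k Z) = X Z) : ∫ Z, inner ℝ (X Z) (Z k) ∂(gaussianSeq n) = 0 := by
  have h1 : ∫ Z, inner ℝ (X Z) (Z k) ∂((gaussianSeq n).map (reflect k)) =
      ∫ Z, inner ℝ (X (reflect k Z)) (reflect k Z k) ∂(gaussianSeq n) :=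
    integral_map (measurable_reflect k).aemeasurable
      (Measurable.aestronglyMeasurable (hX.inner (measurable_pi_apply k)))
  have h2 : ∀ Z : ℕ → Pt n, inner ℝ (X (reflect k Z)) (reflect k Z k) =
      -inner ℝ (X Z) (Z k) := fun Z => by
    rw [h, reflect, if_pos rfl, inner_neg_right]
  simp only [h2, integral_neg, map_reflect] at h1
  linarith

theorem integrable_inner_noise {X : (ℕ → Pt n) → Pt n} (hX : Measurable X) {G : ℝ}
    (hG : ∀ Z, ‖X Z‖ ≤ G) (k : ℕ) :
    Integrable (fun Z => inner ℝ (X Z) (Z k)) (gaussianSeq n) := by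
  refine Integrable.mono' ((integrable_const (G ^ 2)).add (integrable_norm_sq_gaussianSeq k))
    (Measurable.aestronglyMeasurable (hX.inner (measurable_pi_apply k)))
    (Filter.Eventually.of_forall fun Z => ?_)
  have h1 := abs_real_inner_le_norm (X Z) (Z k)
  have h2 : ‖X Z‖ ^ 2 ≤ G ^ 2 := pow_le_pow_left₀ (norm_nonneg _) (hG Z) 2
  rw [Real.norm_eq_abs]
  simp only [Pi.add_apply]
  nlinarith [sq_nonneg (‖X Z‖ - ‖Z k‖), sq_nonneg ‖X Z‖, sq_nonneg ‖Z k‖]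

/-! ### Noisy projected gradient descent -/

theorem norm_projBall_sub_le (ξ : Pt n) {w : Pt n} (hw : ‖w‖ ≤ 1) :
    ‖projBall ξ - w‖ ≤ ‖ξ - w‖ := by
  unfold projBall
  split_ifs with h
  · exact le_rfl
  push Not at h
  have h0 : 0 < ‖ξ‖ := by linarith
  refine le_of_sq_le_sq ?_ (norm_nonneg _)
  rw [norm_sub_sq_real, norm_sub_sq_real, real_inner_smul_left, norm_smul, norm_inv, norm_norm,
    inv_mul_cancel₀ h0.ne']
  have h1 : inner ℝ ξ w ≤ ‖ξ‖ :=
    (real_inner_le_norm ξ w).trans (mul_le_of_le_one_right (norm_nonneg _) hw)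
  have h2 : ‖ξ‖⁻¹ ≤ 1 := inv_le_one_of_one_le₀ h.le
  have h3 : (1 - ‖ξ‖⁻¹) * inner ℝ ξ w ≤ (1 - ‖ξ‖⁻¹) * ‖ξ‖ :=
    mul_le_mul_of_nonneg_left h1 (by linarith)
  rw [sub_mul _ _ ‖ξ‖, inv_mul_cancel₀ h0.ne'] at h3
  nlinarith [sq_nonneg (‖ξ‖ - 1)]

theorem measurable_projBall : Measurable (projBall : Pt n → Pt n) := by
  unfold projBall
  exact Measurable.ite (measurableSet_le measurable_norm measurable_const) measurable_id
    (measurable_norm.inv.smul measurable_id)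

variable {g : Pt n → Pt n} {c σ : ℝ} {φ : Pt n}

theorem norm_dpGrad_le (hφ : ‖φ‖ ≤ 1) (Z : ℕ → Pt n) : ∀ k, ‖dpGrad g c σ Z φ k‖ ≤ 1
  | 0 => hφ
  | _ + 1 => (projBall_nearest _).1

theorem dpGrad_congr {Z Z' : ℕ → Pt n} : ∀ {k : ℕ}, (∀ i < k, Z i = Z' i) →
    dpGrad g c σ Z φ k = dpGrad g c σ Z' φ k
  | 0, _ => rfl
  | k + 1, h => by
    simp only [dpGrad]
    rw [dpGrad_congr (k := k) fun i hi => h i (by omega), h k (by omega)]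

/-- Joint measurability of an iterate in the noise and all parameters. -/
theorem measurable_dpGrad_of {Ω : Type*} [MeasurableSpace Ω] (hg : Measurable g) {c σ : Ω → ℝ}
    {Z : Ω → ℕ → Pt n} {φ : Ω → Pt n} (hc : Measurable c) (hσ : Measurable σ) (hZ : Measurable Z)
    (hφ : Measurable φ) : ∀ k, Measurable fun ω => dpGrad g (c ω) (σ ω) (Z ω) (φ ω) k
  | 0 => hφ
  | k + 1 => by
    have ih := measurable_dpGrad_of hg hc hσ hZ hφ k
    have hZk : Measurable fun ω => Z ω k := (measurable_pi_apply k).comp hZ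
    exact measurable_projBall.comp
      (ih.sub ((hc.div_const _).smul ((hg.comp ih).add (hσ.smul hZk))))

theorem measurable_dpGrad (hg : Measurable g) (k : ℕ) :
    Measurable fun Z : ℕ → Pt n => dpGrad g c σ Z φ k :=
  measurable_dpGrad_of hg measurable_const measurable_const measurable_id measurable_const k

theorem dpGrad_reflect {j k : ℕ} (hjk : j ≤ k) (Z : ℕ → Pt n) :
    dpGrad g c σ (reflect k Z) φ j = dpGrad g c σ Z φ j :=
  dpGrad_congr fun i hi => by unfold reflect; rw [if_neg (by omega)]

theorem exists_norm_le_on_ball {E : Type*} [SeminormedAddCommGroup E] {F : Pt n → E}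
    (hF : Continuous F) : ∃ G, ∀ ψ, ‖ψ‖ ≤ 1 → ‖F ψ‖ ≤ G := by
  obtain ⟨G, hG⟩ := (isCompact_closedBall (0 : Pt n) 1).exists_bound_of_continuousOn hF.continuousOn
  exact ⟨G, fun ψ hψ => hG ψ (by simpa using hψ)⟩

theorem integrable_of_ball {F : Pt n → ℝ} (hF : Continuous F) {Ω : Type*} [MeasurableSpace Ω]
    {μ : Measure Ω} [IsFiniteMeasure μ] {X : Ω → Pt n} (hX : Measurable X) (h : ∀ ω, ‖X ω‖ ≤ 1) :
    Integrable (fun ω => F (X ω)) μ := by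
  obtain ⟨G, hG⟩ := exists_norm_le_on_ball hF
  exact Integrable.of_bound (hF.measurable.comp hX).aestronglyMeasurable G
    (Filter.Eventually.of_forall fun ω => hG _ (h ω))

/-- One step of gradient descent, compared in expectation with a (possibly random) point `w` of the
ball that does not depend on the noise of this step. -/
theorem dpGrad_step {L : Pt n → ℝ} (hL : Continuous L) (hg : Continuous g)
    (hLg : ∀ φ ψ, L φ - L ψ ≤ inner ℝ (g φ) (φ - ψ)) (hc : 0 < c) (hφ : ‖φ‖ ≤ 1)
    {B b l : ℝ} (hB : ∀ ψ, ‖ψ‖ ≤ 1 → ‖g ψ‖ ^ 2 + n * σ ^ 2 ≤ B + b * (L ψ - l))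
    (k : ℕ) {w : (ℕ → Pt n) → Pt n} (hw : Measurable w) (hw1 : ∀ Z, ‖w Z‖ ≤ 1)
    (hwk : ∀ Z, w (reflect k Z) = w Z) :
    2 * (c / √((k : ℝ) + 1)) * (∫ Z, (L (dpGrad g c σ Z φ k) - l) ∂(gaussianSeq n) -
        ∫ Z, (L (w Z) - l) ∂(gaussianSeq n)) ≤
      ∫ Z, ‖dpGrad g c σ Z φ k - w Z‖ ^ 2 ∂(gaussianSeq n) -
        ∫ Z, ‖dpGrad g c σ Z φ (k + 1) - w Z‖ ^ 2 ∂(gaussianSeq n) +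
      (c / √((k : ℝ) + 1)) ^ 2 *
        (B + b * ∫ Z, (L (dpGrad g c σ Z φ k) - l) ∂(gaussianSeq n)) := by
  set η := c / √((k : ℝ) + 1) with hη
  have hη0 : 0 < η := by positivity
  set P : (ℕ → Pt n) → Pt n := fun Z => dpGrad g c σ Z φ k with hP
  set P' : (ℕ → Pt n) → Pt n := fun Z => dpGrad g c σ Z φ (k + 1) with hP'
  have hPm : Measurable P := measurable_dpGrad hg.measurable k
  have hPm' : Measurable P' := measurable_dpGrad hg.measurable (k + 1)
  have hP1 : ∀ Z, ‖P Z‖ ≤ 1 := fun Z => norm_dpGrad_le hφ Z k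
  have hP1' : ∀ Z, ‖P' Z‖ ≤ 1 := fun Z => norm_dpGrad_le hφ Z (k + 1)
  have hPk : ∀ Z, P (reflect k Z) = P Z := fun Z => dpGrad_reflect le_rfl Z
  -- the vector that multiplies the noise
  set X : (ℕ → Pt n) → Pt n := fun Z => η • g (P Z) - (P Z - w Z) with hX
  have hXm : Measurable X := ((hg.measurable.comp hPm).const_smul η).sub (hPm.sub hw)
  obtain ⟨G, hG⟩ := exists_norm_le_on_ball hg
  have hX1 : ∀ Z, ‖X Z‖ ≤ η * G + 2 := fun Z => by
    refine (norm_sub_le _ _).trans (add_le_add ?_ ((norm_sub_le _ _).trans ?_))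
    · rw [norm_smul, Real.norm_eq_abs, abs_of_pos hη0]
      exact mul_le_mul_of_nonneg_left (hG _ (hP1 Z)) hη0.le
    · linarith [hP1 Z, hw1 Z]
  have hXk : ∀ Z, X (reflect k Z) = X Z := fun Z => by simp only [hX, hPk, hwk]
  have hpt : ∀ Z, ‖P' Z - w Z‖ ^ 2 ≤ ‖P Z - w Z‖ ^ 2 - 2 * η * ((L (P Z) - l) - (L (w Z) - l)) +
      η ^ 2 * (B - n * σ ^ 2 + b * (L (P Z) - l)) + (2 * η * σ) * inner ℝ (X Z) (Z k) +
      (η * σ) ^ 2 * ‖Z k‖ ^ 2 := by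
    intro Z
    have h1 : ‖P' Z - w Z‖ ≤ ‖P Z - η • (g (P Z) + σ • Z k) - w Z‖ :=
      norm_projBall_sub_le _ (hw1 Z)
    have h2 : P Z - η • (g (P Z) + σ • Z k) - w Z =
        (P Z - w Z) - (η • g (P Z) + (η * σ) • Z k) := by
      rw [smul_add, smul_smul]; abel
    have h3 : ‖(P Z - w Z) - (η • g (P Z) + (η * σ) • Z k)‖ ^ 2 =
        ‖P Z - w Z‖ ^ 2 - 2 * η * inner ℝ (g (P Z)) (P Z - w Z) + η ^ 2 * ‖g (P Z)‖ ^ 2 +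
          (2 * η * σ) * inner ℝ (X Z) (Z k) + (η * σ) ^ 2 * ‖Z k‖ ^ 2 := by
      have hXZ : inner ℝ (X Z) (Z k) = η * inner ℝ (g (P Z)) (Z k) - inner ℝ (P Z - w Z) (Z k) := by
        simp only [hX]
        rw [inner_sub_left, real_inner_smul_left]
      rw [norm_sub_sq_real, norm_add_sq_real, inner_add_right, real_inner_smul_right,
        real_inner_smul_right, real_inner_smul_left, real_inner_smul_right, norm_smul, norm_smul,
        mul_pow, mul_pow, Real.norm_eq_abs, Real.norm_eq_abs, sq_abs, sq_abs,
        real_inner_comm (g (P Z)) (P Z - w Z), hXZ]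
      ring
    have h4 : ‖P' Z - w Z‖ ^ 2 ≤ ‖(P Z - w Z) - (η • g (P Z) + (η * σ) • Z k)‖ ^ 2 := by
      rw [← h2]; exact pow_le_pow_left₀ (norm_nonneg _) h1 2
    have h5 := mul_le_mul_of_nonneg_left (hLg (P Z) (w Z)) (show 0 ≤ 2 * η by positivity)
    have h6 := mul_le_mul_of_nonneg_left (hB (P Z) (hP1 Z)) (show 0 ≤ η ^ 2 by positivity)
    rw [h3] at h4
    linarith
  have i1 : Integrable (fun Z => ‖P Z - w Z‖ ^ 2) (gaussianSeq n) := by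
    refine Integrable.of_bound (Measurable.aestronglyMeasurable (by fun_prop)) 4
      (Filter.Eventually.of_forall fun Z => ?_)
    rw [Real.norm_eq_abs, abs_of_nonneg (by positivity)]
    have : ‖P Z - w Z‖ ≤ 2 := (norm_sub_le _ _).trans (by linarith [hP1 Z, hw1 Z])
    nlinarith [norm_nonneg (P Z - w Z)]
  have i1' : Integrable (fun Z => ‖P' Z - w Z‖ ^ 2) (gaussianSeq n) := by
    refine Integrable.of_bound (Measurable.aestronglyMeasurable (by fun_prop)) 4
      (Filter.Eventually.of_forall fun Z => ?_)
    rw [Real.norm_eq_abs, abs_of_nonneg (by positivity)]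
    have : ‖P' Z - w Z‖ ≤ 2 := (norm_sub_le _ _).trans (by linarith [hP1' Z, hw1 Z])
    nlinarith [norm_nonneg (P' Z - w Z)]
  have i2 : Integrable (fun Z => L (P Z) - l) (gaussianSeq n) :=
    (integrable_of_ball hL hPm hP1).sub (integrable_const _)
  have i3 : Integrable (fun Z => L (w Z) - l) (gaussianSeq n) :=
    (integrable_of_ball hL hw hw1).sub (integrable_const _)
  have i4 := integrable_inner_noise hXm hX1 k
  have i5 := integrable_norm_sq_gaussianSeq (n := n) k
  have j2 : Integrable (fun Z => 2 * η * ((L (P Z) - l) - (L (w Z) - l))) (gaussianSeq n) :=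
    (i2.sub i3).const_mul _
  have j3 : Integrable (fun Z => η ^ 2 * (B - n * σ ^ 2 + b * (L (P Z) - l))) (gaussianSeq n) :=
    ((integrable_const (B - n * σ ^ 2)).add (i2.const_mul b)).const_mul _
  have j4 : Integrable (fun Z => (2 * η * σ) * inner ℝ (X Z) (Z k)) (gaussianSeq n) :=
    i4.const_mul _
  have j5 : Integrable (fun Z : ℕ → Pt n => (η * σ) ^ 2 * ‖Z k‖ ^ 2) (gaussianSeq n) :=
    i5.const_mul _
  have k2 : Integrable (fun Z => ‖P Z - w Z‖ ^ 2 - 2 * η * ((L (P Z) - l) - (L (w Z) - l)))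
      (gaussianSeq n) := i1.sub j2
  have k3 : Integrable (fun Z => ‖P Z - w Z‖ ^ 2 - 2 * η * ((L (P Z) - l) - (L (w Z) - l)) +
      η ^ 2 * (B - n * σ ^ 2 + b * (L (P Z) - l))) (gaussianSeq n) := k2.add j3
  have k4 : Integrable (fun Z => ‖P Z - w Z‖ ^ 2 - 2 * η * ((L (P Z) - l) - (L (w Z) - l)) +
      η ^ 2 * (B - n * σ ^ 2 + b * (L (P Z) - l)) + (2 * η * σ) * inner ℝ (X Z) (Z k))
      (gaussianSeq n) := k3.add j4
  have hint := integral_mono i1' (k4.add j5) hpt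
  rw [integral_add' k4 j5, integral_add k3 j4, integral_add k2 j3, integral_sub i1 j2,
    integral_const_mul, integral_const_mul, integral_const_mul, integral_const_mul,
    integral_inner_noise_eq_zero hXm k hXk, integral_norm_sq_gaussianSeq, integral_sub i2 i3,
    integral_add (integrable_const _) (i2.const_mul b), integral_const_mul, integral_const,
    probReal_univ, one_smul] at hint
  simp only [hP, hP'] at *
  linarith

/-- Expected excess of the last iterate of noisy gradient descent. -/
theorem dpGrad_excess_le {L : Pt n → ℝ} (hL : Continuous L) (hg : Continuous g)
    (hLg : ∀ φ ψ, L φ - L ψ ≤ inner ℝ (g φ) (φ - ψ)) (hc : 0 < c) (hφ : ‖φ‖ ≤ 1)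
    {φs : Pt n} (hφs : ‖φs‖ ≤ 1) (hmin : ∀ ψ, ‖ψ‖ ≤ 1 → L φs ≤ L ψ)
    {B b : ℝ} (hB0 : 0 ≤ B) (hb0 : 0 ≤ b)
    (hB : ∀ ψ, ‖ψ‖ ≤ 1 → ‖g ψ‖ ^ 2 + n * σ ^ 2 ≤ B + b * (L ψ - L φs)) (N : ℕ)
    (hstep : b * (2 * c / √((N : ℝ) + 1)) * (1 + Real.log (N + 1)) ≤ 1) :
    ∫ Z, (L (dpGrad g c σ Z φ N) - L φs) ∂(gaussianSeq n) ≤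
      3 * (1 + Real.log (N + 1)) * (10 / c + 4 * c * B) / √((N : ℝ) + 1) := by
  have hm : ∀ k, Measurable fun Z : ℕ → Pt n => dpGrad g c σ Z φ k :=
    measurable_dpGrad hg.measurable
  have h1 : ∀ (Z : ℕ → Pt n) k, ‖dpGrad g c σ Z φ k‖ ≤ 1 := fun Z k => norm_dpGrad_le hφ Z k
  have hdist : ∀ w : (ℕ → Pt n) → Pt n, (∀ Z, ‖w Z‖ ≤ 1) → ∀ k,
      ∫ Z, ‖dpGrad g c σ Z φ k - w Z‖ ^ 2 ∂(gaussianSeq n) ≤ 4 := fun w hw k => by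
    have hpt : ∀ Z : ℕ → Pt n, ‖dpGrad g c σ Z φ k - w Z‖ ^ 2 ≤ 4 := fun Z => by
      have : ‖dpGrad g c σ Z φ k - w Z‖ ≤ 2 :=
        (norm_sub_le _ _).trans (by linarith [h1 Z k, hw Z])
      nlinarith [norm_nonneg (dpGrad g c σ Z φ k - w Z)]
    have := integral_mono_of_nonneg (μ := gaussianSeq n)
      (Filter.Eventually.of_forall fun Z => sq_nonneg _) (integrable_const (4 : ℝ))
      (Filter.Eventually.of_forall hpt)
    simpa using this
  refine last_iterate_le hc hB0 hb0
    (e := fun k => ∫ Z, (L (dpGrad g c σ Z φ k) - L φs) ∂(gaussianSeq n))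
    (d := fun j k => ∫ Z, ‖dpGrad g c σ Z φ k - dpGrad g c σ Z φ j‖ ^ 2 ∂(gaussianSeq n))
    (D := fun k => ∫ Z, ‖dpGrad g c σ Z φ k - φs‖ ^ 2 ∂(gaussianSeq n))
    (fun k => integral_nonneg fun Z => sub_nonneg.2 (hmin _ (h1 Z k)))
    (fun j k => integral_nonneg fun Z => sq_nonneg _)
    (fun j k => hdist _ (fun Z => h1 Z j) k) (fun j => by simp)
    (fun k => integral_nonneg fun Z => sq_nonneg _) (fun k => hdist _ (fun _ => hφs) k)
    (fun j k hjk => dpGrad_step hL hg hLg hc hφ hB k (hm j) (fun Z => h1 Z j)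
      (fun Z => dpGrad_reflect hjk Z)) (fun k => ?_) N hstep
  have := dpGrad_step hL hg hLg hc hφ hB k (w := fun _ => φs) measurable_const (fun _ => hφs)
    (fun _ => rfl)
  simpa using this

/-- With tiny step sizes the loss cannot grow much. -/
theorem dpGrad_excess_le_of_small_steps {L : Pt n → ℝ} (hL : Continuous L) (hg : Continuous g)
    (hLg : ∀ φ ψ, L φ - L ψ ≤ inner ℝ (g φ) (φ - ψ)) (hc : 0 < c) (hφ : ‖φ‖ ≤ 1)
    {G : ℝ} (hG : ∀ ψ, ‖ψ‖ ≤ 1 → ‖g ψ‖ ≤ G) (l : ℝ) (N : ℕ) :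
    ∫ Z, (L (dpGrad g c σ Z φ N) - l) ∂(gaussianSeq n) ≤
      L φ - l + G * (N * (c * (G + (1 + n * σ ^ 2)))) := by
  have h1 : ∀ (Z : ℕ → Pt n) k, ‖dpGrad g c σ Z φ k‖ ≤ 1 := fun Z k => norm_dpGrad_le hφ Z k
  have hG0 : 0 ≤ G := (norm_nonneg _).trans (hG φ hφ)
  have hmove : ∀ (Z : ℕ → Pt n) k, ‖dpGrad g c σ Z φ k - φ‖ ≤
      ∑ i ∈ Finset.range k, c * (G + (1 + σ ^ 2 * ‖Z i‖ ^ 2)) := by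
    intro Z k
    induction k with
    | zero => simp [dpGrad]
    | succ k ih =>
      rw [Finset.sum_range_succ]
      refine (norm_projBall_sub_le _ hφ).trans ?_
      rw [sub_right_comm]
      refine (norm_sub_le _ _).trans (add_le_add ih ?_)
      rw [norm_smul, Real.norm_eq_abs, abs_of_pos (by positivity)]
      have h2 : c / √((k : ℝ) + 1) ≤ c :=
        div_le_self hc.le (Real.one_le_sqrt.2 (by
          have : (0 : ℝ) ≤ k := by positivity
          linarith))
      have h3 : ‖σ • Z k‖ ≤ 1 + σ ^ 2 * ‖Z k‖ ^ 2 := by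
        have : σ ^ 2 * ‖Z k‖ ^ 2 = ‖σ • Z k‖ ^ 2 := by
          rw [norm_smul, mul_pow, Real.norm_eq_abs, sq_abs]
        rw [this]; nlinarith [sq_nonneg (‖σ • Z k‖ - 1)]
      have h4 : ‖g (dpGrad g c σ Z φ k) + σ • Z k‖ ≤ G + (1 + σ ^ 2 * ‖Z k‖ ^ 2) :=
        (norm_add_le _ _).trans (add_le_add (hG _ (h1 Z k)) h3)
      gcongr
  have hi : ∀ i, Integrable (fun Z : ℕ → Pt n => c * (G + (1 + σ ^ 2 * ‖Z i‖ ^ 2)))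
      (gaussianSeq n) := fun i =>
    ((integrable_const G).add ((integrable_const 1).add
      ((integrable_norm_sq_gaussianSeq i).const_mul _))).const_mul _
  have hI : ∀ i, ∫ Z : ℕ → Pt n, c * (G + (1 + σ ^ 2 * ‖Z i‖ ^ 2)) ∂(gaussianSeq n) =
      c * (G + (1 + n * σ ^ 2)) := fun i => by
    have h2 : Integrable (fun Z : ℕ → Pt n => σ ^ 2 * ‖Z i‖ ^ 2) (gaussianSeq n) :=
      (integrable_norm_sq_gaussianSeq i).const_mul _
    have h3 : Integrable (fun Z : ℕ → Pt n => 1 + σ ^ 2 * ‖Z i‖ ^ 2) (gaussianSeq n) :=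
      (integrable_const 1).add h2
    rw [integral_const_mul, integral_add (integrable_const G) h3,
      integral_add (integrable_const 1) h2, integral_const_mul, integral_norm_sq_gaussianSeq]
    simp [mul_comm]
  have hpt : ∀ Z : ℕ → Pt n, L (dpGrad g c σ Z φ N) - l ≤
      (L φ - l) + G * ∑ i ∈ Finset.range N, c * (G + (1 + σ ^ 2 * ‖Z i‖ ^ 2)) := fun Z => by
    have h2 := hLg (dpGrad g c σ Z φ N) φ
    have h3 := real_inner_le_norm (g (dpGrad g c σ Z φ N)) (dpGrad g c σ Z φ N - φ)
    have h4 := mul_le_mul (hG _ (h1 Z N)) (hmove Z N) (norm_nonneg _) hG0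
    linarith
  have hs : Integrable (fun Z : ℕ → Pt n => ∑ i ∈ Finset.range N, c * (G + (1 + σ ^ 2 * ‖Z i‖ ^ 2)))
      (gaussianSeq n) := integrable_finsetSum _ fun i _ => hi i
  refine (integral_mono ((integrable_of_ball hL (measurable_dpGrad hg.measurable N)
    (fun Z => h1 Z N)).sub (integrable_const l)) ((integrable_const _).add (hs.const_mul G))
    hpt).trans (le_of_eq ?_)
  rw [integral_add' (integrable_const _) (hs.const_mul G), integral_const_mul,
    integral_finsetSum _ fun i _ => hi i]
  simp [hI]

end NoisyDescent

/-! ### The learning rate rule and a single run of gradient descent -/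

/-- The learning rate rule. A run of full length uses `c = 1`. Any other run is a warm start from
a point whose gradient has norm at most `s = √n σ`, so that its excess loss is at most `2 s`. If `s`
is already of the order of the target accuracy `log T / √T`, it suffices not to move away from the
initial point; otherwise the appropriate scale is `c = 1 / √s`. -/
def rateRule (κ : ℝ) : RateRule := fun n T T' σ _ =>
  if T' = T then 1
  else if √n * σ ≤ 16 * κ * (Real.log T / √T) then 1 / ((T : ℝ) + 1) ^ 2
  else (√(√n * σ))⁻¹

theorem rateRule_pos {κ : ℝ} (hκ : 0 < κ) (n T T' : ℕ) (σ β : ℝ) : 0 < rateRule κ n T T' σ β := by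
  unfold rateRule
  split_ifs with h1 h2
  · exact one_pos
  · positivity
  · have : 0 ≤ Real.log T / √T := div_nonneg (Real.log_natCast_nonneg T) (Real.sqrt_nonneg _)
    have : 0 ≤ 16 * κ * (Real.log T / √T) := by positivity
    push Not at h2
    exact inv_pos.2 (Real.sqrt_pos.2 (by linarith))

theorem half_le_log {T : ℕ} (hT : 2 ≤ T) : 1 / 2 ≤ Real.log T := by
  have h : Real.log 2 ≤ Real.log T := Real.log_le_log (by norm_num) (by exact_mod_cast hT)
  linarith [Real.log_two_gt_d9]

theorem one_lt_log {T : ℕ} (hT : 3 ≤ T) : 1 < Real.log T := by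
  rw [Real.lt_log_iff_exp_lt (by positivity)]
  have : (3 : ℝ) ≤ T := by exact_mod_cast hT
  linarith [Real.exp_one_lt_d9]

/-- A warm start that does not use all `T` iterates uses `⌈s √(log T) T⌉` of them, where `s = √n σ`:
the exponent of the definition is such that `s ^ (-1 / (2 a)) = √(log T)`. -/
theorem warmIters_eq {n T : ℕ} {σ : ℝ} (hT : 3 ≤ T) (hs : 0 < √n * σ) (h : warmIters n T σ ≠ T) :
    √n * σ * √(Real.log T) < 1 ∧ warmIters n T σ = ⌈√n * σ * √(Real.log T) * T⌉₊ := by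
  have hl := one_lt_log hT
  have hll : 0 < Real.log (Real.log T) := Real.log_pos hl
  set s := √n * σ
  have hsq : √(Real.log T) = Real.exp (Real.log (Real.log T) / 2) := by
    rw [Real.sqrt_eq_rpow, Real.rpow_def_of_pos (by linarith)]; congr 1; ring
  unfold warmIters at h ⊢
  simp only at h ⊢
  change (if 1 / 2 < Real.log (1 / s) / Real.log (Real.log T) then
    ⌈s ^ (1 - 1 / (2 * (Real.log (1 / s) / Real.log (Real.log T)))) * T⌉₊ else T) ≠ T at h
  change _ ∧ (if 1 / 2 < Real.log (1 / s) / Real.log (Real.log T) then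
    ⌈s ^ (1 - 1 / (2 * (Real.log (1 / s) / Real.log (Real.log T)))) * T⌉₊ else T) = _
  split_ifs at h ⊢ with ha
  · rw [one_div s, Real.log_inv] at ha ⊢
    rw [lt_div_iff₀ hll] at ha
    have hs0 : Real.log s ≠ 0 := by intro h0; rw [h0] at ha; linarith
    refine ⟨?_, ?_⟩
    · rw [hsq, ← Real.exp_log hs, ← Real.exp_add, Real.exp_lt_one_iff]
      linarith
    · congr 2
      rw [Real.rpow_def_of_pos hs, hsq]
      nth_rewrite 3 [← Real.exp_log hs]
      rw [← Real.exp_add]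
      congr 1
      field_simp
      ring
  · exact absurd rfl h

section Run

variable {κ : ℝ} {n m : ℕ} {x : Fin m → Pt n} {f : Pt n → ℝ} {z φ : Pt n} {σ : ℝ}

theorem nat_mul_sq_eq : (n : ℝ) * σ ^ 2 = (√n * σ) ^ 2 := by
  rw [mul_pow, Real.sq_sqrt (Nat.cast_nonneg n)]

/-- Gradient descent of full length `T` with `c = 1`. -/
theorem full_run_excess_le (hκ : 0 < κ) (hf : ∀ i, |f (x i)| ≤ 1) (hφ : ‖φ‖ ≤ 1) (hσ : 0 ≤ σ)
    {K : ℝ} (hK : √n * σ ≤ K) {T : ℕ} (hT : 2 ≤ T) :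
    ∫ Z, (loss κ x f z (dpGrad (lossGrad κ x f z) 1 σ Z φ (T - 1)) - optLoss κ x f z)
      ∂(gaussianSeq n) ≤ 9 * (10 + 4 * (κ ^ 2 + K ^ 2)) * (Real.log T / √T) := by
  obtain ⟨φs, hφs, h1, h2⟩ := exists_optimal κ x f z
  have hs0 : 0 ≤ √n * σ := by positivity
  have hT1 : ((T - 1 : ℕ) : ℝ) + 1 = T := by
    rw [Nat.cast_sub (by omega)]; simp
  have h := dpGrad_excess_le (L := loss κ x f z) (g := lossGrad κ x f z) (c := 1) (σ := σ) (φ := φ)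
    (φs := φs) continuous_loss (continuous_lossGrad hκ) (loss_sub_le_inner hκ) one_pos hφ
    (by simpa using hφs) (fun ψ hψ => h2 ψ (by simpa using hψ)) (B := κ ^ 2 + K ^ 2) (b := 0)
    (by positivity) le_rfl (fun ψ hψ => by
      have h3 := pow_le_pow_left₀ (norm_nonneg _)
        (norm_lossGrad_le (x := x) (f := f) (z := z) hκ hf hψ) 2
      have h4 := pow_le_pow_left₀ hs0 hK 2
      rw [nat_mul_sq_eq, zero_mul, add_zero]
      exact add_le_add h3 h4) (T - 1) (by simp)
  rw [h1, hT1] at h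
  refine h.trans ?_
  rw [← mul_div_assoc]
  refine div_le_div_of_nonneg_right ?_ (Real.sqrt_nonneg _)
  have := half_le_log hT
  have : 0 ≤ 10 + 4 * (κ ^ 2 + K ^ 2) := by positivity
  nlinarith

theorem loss_sub_optLoss_le_gradient (hκ : 0 < κ) (hφ : ‖φ‖ ≤ 1) :
    loss κ x f z φ - optLoss κ x f z ≤ 2 * ‖lossGrad κ x f z φ‖ := by
  obtain ⟨φs, hφs, h1, -⟩ := exists_optimal κ x f z
  rw [← h1]
  refine (loss_sub_le_inner hκ φ φs).trans ((real_inner_le_norm _ _).trans ?_)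
  have : ‖φ - φs‖ ≤ 2 := (norm_sub_le _ _).trans (by
    have : ‖φs‖ ≤ 1 := by simpa using hφs
    linarith)
  rw [mul_comm]
  exact mul_le_mul_of_nonneg_right this (norm_nonneg _)

/-- If the gradient is small at one point of the ball, it is small wherever the excess loss is. -/
theorem norm_lossGrad_sq_le_of_warm (hκ : 0 < κ) (hφ : ‖φ‖ ≤ 1) {s : ℝ} (hs1 : s ≤ 1)
    (hgrad : ‖lossGrad κ x f z φ‖ ≤ s) {ψ : Pt n} (hψ : ‖ψ‖ ≤ 1) :
    ‖lossGrad κ x f z ψ‖ ^ 2 + s ^ 2 ≤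
      (5 + 16 * κ) * s + 4 * κ * (loss κ x f z ψ - optLoss κ x f z) := by
  have h0 := loss_sub_optLoss_le_gradient (x := x) (f := f) (z := z) hκ hφ
  obtain ⟨φs, hφs, h1, h2⟩ := exists_optimal κ x f z
  have hφs' : ‖φs‖ ≤ 1 := by simpa using hφs
  -- increments of the gradient from the minimizer are controlled by the excess loss
  have key : ∀ ξ : Pt n, ‖ξ‖ ≤ 1 → ‖lossGrad κ x f z ξ - lossGrad κ x f z φs‖ ^ 2 ≤
      2 * κ * (loss κ x f z ξ - optLoss κ x f z) := fun ξ hξ => by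
    refine (norm_lossGrad_sub_sq_le hκ ξ φs).trans ?_
    have h3 := loss_expand (x := x) (f := f) (z := z) hκ ξ φs
    have h4 := inner_lossGrad_nonneg hκ hφs' h2 hξ
    rw [← h1]
    gcongr
    linarith
  have tri : ∀ a b : Pt n, ‖a‖ ^ 2 ≤ 2 * ‖b‖ ^ 2 + 2 * ‖a - b‖ ^ 2 := fun a b => by
    have h3 : ‖a‖ ≤ ‖b‖ + ‖a - b‖ := by
      simpa using norm_add_le b (a - b)
    have h4 := pow_le_pow_left₀ (norm_nonneg _) h3 2
    nlinarith [sq_nonneg (‖b‖ - ‖a - b‖)]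
  have e1 := key φ hφ
  have e2 := key ψ hψ
  have e3 := tri (lossGrad κ x f z φs) (lossGrad κ x f z φ)
  have e4 := tri (lossGrad κ x f z ψ) (lossGrad κ x f z φs)
  rw [norm_sub_rev] at e3
  have hs0 : 0 ≤ s := (norm_nonneg _).trans hgrad
  have e5 : ‖lossGrad κ x f z φ‖ ^ 2 ≤ s ^ 2 := pow_le_pow_left₀ (norm_nonneg _) hgrad 2
  have e6 : s ^ 2 ≤ s := by nlinarith
  have e7 : 2 * κ * (loss κ x f z φ - optLoss κ x f z) ≤ 2 * κ * (2 * s) := by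
    gcongr; linarith
  linarith

/-- A warm start with step sizes that are too small to leave a good initial point. -/
theorem short_run_excess_le (hκ : 0 < κ) (hf : ∀ i, |f (x i)| ≤ 1) (hφ : ‖φ‖ ≤ 1) (hσ : 0 ≤ σ)
    (hgrad : ‖lossGrad κ x f z φ‖ ≤ √n * σ) {K : ℝ} (hK : √n * σ ≤ K) {T T' : ℕ} (hT : 2 ≤ T)
    (hT' : T' ≤ T) (hsmall : √n * σ ≤ 16 * κ * (Real.log T / √T)) :
    ∫ Z, (loss κ x f z (dpGrad (lossGrad κ x f z) (1 / ((T : ℝ) + 1) ^ 2) σ Z φ (T' - 1)) -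
      optLoss κ x f z) ∂(gaussianSeq n) ≤
        (32 * κ + 2 * κ * (κ + (1 + K ^ 2))) * (Real.log T / √T) := by
  have h := dpGrad_excess_le_of_small_steps (L := loss κ x f z) (g := lossGrad κ x f z)
    (c := 1 / ((T : ℝ) + 1) ^ 2) (σ := σ) (φ := φ) continuous_loss (continuous_lossGrad hκ)
    (loss_sub_le_inner hκ) (by positivity) hφ (fun ψ hψ => norm_lossGrad_le hκ hf hψ)
    (optLoss κ x f z) (T' - 1)
  refine h.trans ?_
  have h0 := loss_sub_optLoss_le_gradient (x := x) (f := f) (z := z) hκ hφ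
  have hT0 : (0 : ℝ) < T := by positivity
  have hl := half_le_log hT
  have hs0 : 0 ≤ √n * σ := by positivity
  have h1 : ((T' - 1 : ℕ) : ℝ) ≤ T := by exact_mod_cast (Nat.sub_le _ _).trans hT'
  have h2 : (T : ℝ) * (1 / ((T : ℝ) + 1) ^ 2) ≤ 2 * (Real.log T / √T) := by
    have h3 : (T : ℝ) * (1 / ((T : ℝ) + 1) ^ 2) ≤ 1 / T := by
      rw [mul_one_div, div_le_div_iff₀ (by positivity) hT0]; nlinarith
    have h4 : 1 / (T : ℝ) ≤ 1 / √T := by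
      gcongr
      rw [Real.sqrt_le_left hT0.le]
      have : (1 : ℝ) ≤ T := by exact_mod_cast (by omega : 1 ≤ T)
      nlinarith
    have h5 : 1 / √(T : ℝ) ≤ 2 * (Real.log T / √T) := by
      rw [← mul_div_assoc]; gcongr; linarith
    linarith
  have h6 : ((T' - 1 : ℕ) : ℝ) * (1 / ((T : ℝ) + 1) ^ 2 * (κ + (1 + n * σ ^ 2))) ≤
      2 * (Real.log T / √T) * (κ + (1 + K ^ 2)) := by
    rw [nat_mul_sq_eq]
    calc _ ≤ (T : ℝ) * (1 / ((T : ℝ) + 1) ^ 2 * (κ + (1 + K ^ 2))) := by gcongr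
      _ = (T : ℝ) * (1 / ((T : ℝ) + 1) ^ 2) * (κ + (1 + K ^ 2)) := by ring
      _ ≤ _ := by gcongr
  have h7 := mul_le_mul_of_nonneg_left h6 hκ.le
  linarith

/-- A warm start with `s = √n σ` above the target accuracy. Smoothness keeps the second moment of
the stochastic gradient of order `s` plus the excess loss, and this compensates for the smaller
number of iterates, about `s T`. -/
theorem warm_run_excess_le (hκ : 0 < κ) (hφ : ‖φ‖ ≤ 1)
    (hgrad : ‖lossGrad κ x f z φ‖ ≤ √n * σ) {T : ℕ} (hT : 3 ≤ T)
    (hs1 : √n * σ * √(Real.log T) < 1) (hlarge : 16 * κ * (Real.log T / √T) < √n * σ) :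
    ∫ Z, (loss κ x f z (dpGrad (lossGrad κ x f z) (√(√n * σ))⁻¹ σ Z φ
      (⌈√n * σ * √(Real.log T) * T⌉₊ - 1)) - optLoss κ x f z) ∂(gaussianSeq n) ≤
        6 * (30 + 64 * κ) * (Real.log T / √T) := by
  have hwarm := fun ψ : Pt n => norm_lossGrad_sq_le_of_warm (x := x) (f := f) (z := z)
    (s := √n * σ) (ψ := ψ) hκ hφ
  set s := √n * σ with hs
  have hl := one_lt_log hT
  have hT0 : (0 : ℝ) < T := by positivity
  have hT0' : 0 < √(T : ℝ) := Real.sqrt_pos.2 hT0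
  have hs0 : 0 < s := lt_of_le_of_lt (by positivity) hlarge
  have hsl : 1 ≤ √(Real.log T) := Real.one_le_sqrt.2 hl.le
  have hs1' : s ≤ 1 := by nlinarith
  set r := √s with hr
  have hr0 : 0 < r := Real.sqrt_pos.2 hs0
  have hrr : r * r = s := Real.mul_self_sqrt hs0.le
  set T' := ⌈s * √(Real.log T) * T⌉₊ with hT'
  have hT'1 : s * T ≤ T' := by
    refine le_trans ?_ (Nat.le_ceil _)
    exact mul_le_mul_of_nonneg_right (le_mul_of_one_le_right hs0.le hsl) hT0.le
  have hT'T : T' ≤ T := by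
    rw [hT', Nat.ceil_le]; nlinarith
  have hT'0 : 0 < T' := Nat.ceil_pos.2 (by positivity)
  have hN : ((T' - 1 : ℕ) : ℝ) + 1 = T' := by
    rw [Nat.cast_sub (by omega)]; simp
  have hT'r : (0 : ℝ) < T' := by exact_mod_cast hT'0
  have hR : r * √T ≤ √T' := by
    rw [hr, ← Real.sqrt_mul hs0.le]; exact Real.sqrt_le_sqrt hT'1
  have hR0 : 0 < r * √T := by positivity
  have hlog : 1 + Real.log T' ≤ 2 * Real.log T := by
    have : Real.log T' ≤ Real.log T := Real.log_le_log hT'r (by exact_mod_cast hT'T)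
    linarith
  have hlog0 : 0 ≤ 1 + Real.log T' := by
    have := Real.log_natCast_nonneg T'
    linarith
  obtain ⟨φs, hφs, h1, h2⟩ := exists_optimal κ x f z
  have h := dpGrad_excess_le (L := loss κ x f z) (g := lossGrad κ x f z) (c := r⁻¹) (σ := σ)
    (φ := φ) (φs := φs) continuous_loss (continuous_lossGrad hκ) (loss_sub_le_inner hκ)
    (inv_pos.2 hr0) hφ (by simpa using hφs) (fun ψ hψ => h2 ψ (by simpa using hψ))
    (B := (5 + 16 * κ) * s) (b := 4 * κ) (by positivity) (by positivity)
    (fun ψ hψ => by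
      rw [nat_mul_sq_eq, h1]
      exact hwarm ψ hs1' hgrad hψ) (T' - 1) (by
      rw [hN]
      have h3 : 2 * r⁻¹ / √T' ≤ 2 * r⁻¹ / (r * √T) := by gcongr
      have h4 : 2 * r⁻¹ / (r * √T) = 2 / (s * √T) := by
        rw [← hrr]; field_simp
      rw [h4] at h3
      have h5 : 16 * κ * Real.log T ≤ s * √T := by
        rw [← mul_div_assoc, div_lt_iff₀ hT0'] at hlarge
        exact hlarge.le
      calc 4 * κ * (2 * r⁻¹ / √T') * (1 + Real.log T')
          ≤ 4 * κ * (2 / (s * √T)) * (2 * Real.log T) := by gcongr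
        _ = 16 * κ * Real.log T / (s * √T) := by ring
        _ ≤ 1 := by rw [div_le_one (by positivity)]; exact h5)
  rw [h1, hN] at h
  refine h.trans ?_
  have h6 : 10 / r⁻¹ + 4 * r⁻¹ * ((5 + 16 * κ) * s) = (30 + 64 * κ) * r := by
    rw [← hrr]; field_simp; ring
  rw [h6]
  calc 3 * (1 + Real.log T') * ((30 + 64 * κ) * r) / √T'
      ≤ 3 * (2 * Real.log T) * ((30 + 64 * κ) * r) / (r * √T) := by gcongr
    _ = _ := by field_simp; ring

/-- The constant in the accuracy of a single run, when `√n σ ≤ K`. -/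
def runConst (κ K : ℝ) : ℝ :=
  9 * (10 + 4 * (κ ^ 2 + K ^ 2)) + (32 * κ + 2 * κ * (κ + (1 + K ^ 2))) + 6 * (30 + 64 * κ) +
    3 * (1 + κ)

theorem runConst_nonneg (hκ : 0 < κ) (K : ℝ) : 0 ≤ runConst κ K := by
  unfold runConst; positivity

/-- Accuracy of a single run of gradient descent, either of full length from an arbitrary initial
point or from a warm start with a correspondingly small gradient. -/
theorem run_excess_le (hκ : 0 < κ) (hf : ∀ i, |f (x i)| ≤ 1) (hφ : ‖φ‖ ≤ 1) (hσ : 0 < √n * σ)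
    {K : ℝ} (hK : √n * σ ≤ K) {T T' : ℕ} (hT : 2 ≤ T) (β : ℝ)
    (hT' : T' = T ∨ T' = warmIters n T σ ∧ ‖lossGrad κ x f z φ‖ ≤ √n * σ) :
    ∫ Z, (loss κ x f z (dpGrad (lossGrad κ x f z) (rateRule κ n T T' σ β) σ Z φ (T' - 1)) -
      optLoss κ x f z) ∂(gaussianSeq n) ≤ runConst κ K * (Real.log T / √T) := by
  have hσ0 : 0 ≤ σ := by
    by_contra hc
    push Not at hc
    have := mul_nonpos_of_nonneg_of_nonpos (Real.sqrt_nonneg n) hc.le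
    linarith
  have hq : 0 ≤ Real.log T / √T := div_nonneg (Real.log_natCast_nonneg T) (Real.sqrt_nonneg _)
  have p1 : 0 ≤ 9 * (10 + 4 * (κ ^ 2 + K ^ 2)) := by positivity
  have p2 : 0 ≤ 32 * κ + 2 * κ * (κ + (1 + K ^ 2)) := by positivity
  have p3 : 0 ≤ 6 * (30 + 64 * κ) := by positivity
  have p4 : 0 ≤ 3 * (1 + κ) := by positivity
  by_cases hTT : T' = T
  · rw [rateRule, if_pos hTT, hTT]
    refine (full_run_excess_le hκ hf hφ hσ0 hK hT).trans ?_
    gcongr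
    unfold runConst; linarith
  · obtain ⟨hw, hgrad⟩ := hT'.resolve_left hTT
    rcases Nat.eq_or_lt_of_le hT with h2 | h3
    · -- for `T = 2` the bound exceeds every value of the loss
      have hpt : ∀ Z : ℕ → Pt n, loss κ x f z (dpGrad (lossGrad κ x f z)
          (rateRule κ n T T' σ β) σ Z φ (T' - 1)) - optLoss κ x f z ≤ 1 + κ := fun Z => by
        have := loss_le (x := x) (f := f) (z := z) hκ hf
          (norm_dpGrad_le (g := lossGrad κ x f z) (c := rateRule κ n T T' σ β) (σ := σ) hφ Z (T' - 1))
        linarith [optLoss_nonneg (x := x) (f := f) (z := z) hκ]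
      have h := integral_mono_of_nonneg (μ := gaussianSeq n)
        (Filter.Eventually.of_forall fun Z => sub_nonneg.2 (optLoss_le (norm_dpGrad_le hφ Z _)))
        (integrable_const (1 + κ)) (Filter.Eventually.of_forall hpt)
      refine h.trans ?_
      rw [integral_const, probReal_univ, one_smul]
      have h4 : 1 ≤ 3 * (Real.log T / √T) := by
        have hT2 : (T : ℝ) = 2 := by rw [← h2]; norm_num
        have h5 : √(2 : ℝ) ≤ 3 / 2 := by
          rw [Real.sqrt_le_left (by norm_num)]; norm_num
        rw [hT2, ← mul_div_assoc, one_le_div (by positivity)]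
        linarith [Real.log_two_gt_d9]
      calc 1 + κ ≤ (1 + κ) * (3 * (Real.log T / √T)) := le_mul_of_one_le_right (by positivity) h4
        _ = 3 * (1 + κ) * (Real.log T / √T) := by ring
        _ ≤ _ := by gcongr; unfold runConst; linarith
    · obtain ⟨hs1, hTe⟩ := warmIters_eq h3 hσ (hw ▸ hTT)
      rw [rateRule, if_neg hTT]
      split_ifs with hsm
      · have hle : T' ≤ T := by
          rw [hw, hTe, Nat.ceil_le]
          exact mul_le_of_le_one_left (Nat.cast_nonneg T) hs1.le
        refine (short_run_excess_le hκ hf hφ hσ0 hgrad hK hT hle hsm).trans ?_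
        gcongr
        unfold runConst; linarith
      · push Not at hsm
        rw [hw, hTe]
        refine (warm_run_excess_le hκ hφ hgrad h3 hs1 hsm).trans ?_
        gcongr
        unfold runConst; linarith

end Run

/-! ### Measurability of the protocol -/

section Measurability

variable {Ω : Type*} [MeasurableSpace Ω]

theorem measurable_apply_nat {α : Type*} [MeasurableSpace α] {F : Ω → ℕ → α}
    (hF : ∀ k, Measurable fun ω => F ω k) {N : Ω → ℕ} (hN : Measurable N) :
    Measurable fun ω => F ω (N ω) := by
  have h : Measurable fun p : Ω × ℕ => F p.1 p.2 := measurable_from_prod_countable_left hF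
  exact h.comp (measurable_id.prodMk hN)

theorem measurable_sample (k : ℕ) {w : Ω → ℕ → ℝ} (hw : ∀ i, Measurable fun ω => w ω i)
    {u : Ω → ℝ} (hu : Measurable u) : Measurable fun ω => sample k (w ω) (u ω) := by
  unfold sample
  simp only [Finset.card_filter]
  refine Finset.measurable_fun_sum _ fun j _ => Measurable.ite ?_ measurable_const measurable_const
  exact measurableSet_le (Finset.measurable_fun_sum _ fun i _ => hw i)
    (hu.mul (Finset.measurable_fun_sum _ fun i _ => hw i))

theorem measurable_warmIters (n T : ℕ) : Measurable (warmIters n T) := by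
  unfold warmIters
  refine Measurable.ite (measurableSet_lt measurable_const (by fun_prop))
    (Nat.measurable_ceil.comp (by fun_prop)) measurable_const

theorem measurable_rateRule (κ : ℝ) (n T : ℕ) {N : Ω → ℕ} {σ β : Ω → ℝ} (hN : Measurable N)
    (hσ : Measurable σ) : Measurable fun ω => rateRule κ n T (N ω) (σ ω) (β ω) := by
  unfold rateRule
  refine Measurable.ite (hN (measurableSet_singleton T)) measurable_const
    (Measurable.ite (measurableSet_le (by fun_prop) measurable_const) measurable_const
      (by fun_prop))

namespace Input

variable {κ : ℝ} {n m : ℕ} (I : Input n m)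

theorem measurable_params (hκ : 0 < κ) (h : ℕ) {past : Ω → ℕ → Pt n}
    (hp : ∀ j, Measurable fun ω => past ω j) {u : Ω → unitInterval} (hu : Measurable u) :
    Measurable fun ω => I.params κ h (past ω) (u ω) := by
  unfold params
  split_ifs with h0
  · exact measurable_const
  · have hg : Measurable (lossGrad κ I.x I.f (I.z h)) := (continuous_lossGrad hκ).measurable
    have hbest : Measurable fun ω => past ω (sample h (fun j => Real.exp
        (-(m * epsIte I.T I.εmin I.δmin * (‖lossGrad κ I.x I.f (I.z h) (past ω j)‖ / 2))))
          (u ω)) := by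
      refine measurable_apply_nat hp (measurable_sample h (fun j => ?_)
        (measurable_subtype_coe.comp hu))
      have := hg.comp (hp j)
      exact Real.measurable_exp.comp (((this.norm.div_const 2).const_mul _).neg)
    have hσ := (((hg.comp hbest).norm.div_const √n).max
      (measurable_const (a := sigmaMin m I.T I.εmin I.δmin)))
    exact hbest.prodMk (hσ.prodMk ((measurable_warmIters n I.T).comp hσ))

theorem measurable_next (hκ : 0 < κ) (h : ℕ) {past : Ω → ℕ → Pt n}
    (hp : ∀ j, Measurable fun ω => past ω j) {ζ : Ω → (ℕ → Pt n) × unitInterval}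
    (hζ : Measurable ζ) : Measurable fun ω => I.next κ (rateRule κ) h (past ω) (ζ ω) := by
  unfold next
  split_ifs with h0
  · exact hp _
  · have hg : Measurable (lossGrad κ I.x I.f (I.z h)) := (continuous_lossGrad hκ).measurable
    have hpar := I.measurable_params hκ h hp hζ.snd
    have hN := hpar.snd.snd
    have hσ := hpar.snd.fst
    exact measurable_apply_nat (fun k => measurable_dpGrad_of hg
      (measurable_rateRule κ n I.T hN hσ (β := fun ω => ‖lossGrad κ I.x I.f (I.z h)
        (I.params κ h (past ω) (ζ ω).2).1‖)) hσ hζ.fst hpar.fst k)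
      ((measurable_from_top (f := fun k : ℕ => k - 1)).comp hN)

theorem measurable_history (hκ : 0 < κ) (h : ℕ) :
    ∀ j, Measurable fun ω : Noise n => I.history κ (rateRule κ) ω h j := by
  induction h with
  | zero => exact fun j => measurable_const
  | succ h ih =>
    intro j
    simp only [history, Function.update_apply]
    split_ifs with hj
    · exact I.measurable_next hκ h ih (measurable_pi_apply h)
    · exact ih j

theorem measurable_answer (hκ : 0 < κ) (h : ℕ) : Measurable (I.answer κ (rateRule κ) h) :=
  I.measurable_next hκ h (I.measurable_history hκ h) (measurable_pi_apply h)

theorem measurable_used (hκ : 0 < κ) (h : ℕ) :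
    Measurable fun ω : Noise n => I.used κ (rateRule κ) ω h := by
  unfold used
  split_ifs
  · exact measurable_const
  · exact (I.measurable_params hκ h (I.measurable_history hκ h) (measurable_pi_apply h).snd).snd

theorem measurableSet_released (hκ : 0 < κ) (h : ℕ) :
    MeasurableSet (I.released κ (rateRule κ) h) := by
  have : I.released κ (rateRule κ) h = ⋂ j, ⋂ (_ : j ≤ h), ⋂ (_ : I.src j = j),
      {ω | ¬ (I.ε < (I.spent j fun i => I.used κ (rateRule κ) ω i).1 ∨
       I.δ ≤ (I.spent j fun i => I.used κ (rateRule κ) ω i).2)} := by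
    ext ω; simp [released]
  rw [this]
  refine MeasurableSet.iInter fun j => MeasurableSet.iInter fun _ => MeasurableSet.iInter fun _ => ?_
  have hs : Measurable fun ω : Noise n =>
      I.spent j fun i : Fin (j + 1) => I.used κ (rateRule κ) ω i :=
    (I.measurable_spent j).comp (measurable_pi_lambda _ fun i => I.measurable_used hκ i)
  exact ((measurableSet_lt measurable_const hs.fst).union
    (measurableSet_le measurable_const hs.snd)).compl

/-! ### Explanations in the unit ball and their dependence on the noise -/

variable {I} {ρ : RateRule}

theorem norm_params_le {h : ℕ} {past : ℕ → Pt n} (hp : ∀ j, ‖past j‖ ≤ 1) (u : unitInterval) :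
    ‖(I.params κ h past u).1‖ ≤ 1 := by
  unfold params
  split_ifs
  · exact I.init_le
  · exact hp _

theorem norm_next_le {h : ℕ} {past : ℕ → Pt n} (hp : ∀ j, ‖past j‖ ≤ 1)
    (ζ : (ℕ → Pt n) × unitInterval) : ‖I.next κ ρ h past ζ‖ ≤ 1 := by
  unfold next
  split_ifs
  · exact hp _
  · exact norm_dpGrad_le (norm_params_le hp _) _ _

theorem norm_history_le (ω : Noise n) (h j : ℕ) : ‖I.history κ ρ ω h j‖ ≤ 1 := by
  induction h generalizing j with
  | zero => simp [history]
  | succ h ih =>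
    simp only [history, Function.update_apply]
    split_ifs
    · exact norm_next_le ih _
    · exact ih j

theorem norm_answer_le (ω : Noise n) (h : ℕ) : ‖I.answer κ ρ h ω‖ ≤ 1 :=
  norm_next_le (norm_history_le ω h) _

theorem history_eq_answer (ω : Noise n) {j h : ℕ} (hj : j < h) :
    I.history κ ρ ω h j = I.answer κ ρ j ω := by
  induction h with
  | zero => omega
  | succ h ih =>
    simp only [history, Function.update_apply]
    split_ifs with hjh
    · rw [hjh]; rfl
    · exact ih (by omega)

theorem answer_eq_answer_src (ω : Noise n) (h : ℕ) :
    I.answer κ ρ h ω = I.answer κ ρ (I.src h) ω := by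
  rcases I.isSource h with ⟨h1, -, -⟩ | ⟨h1, -⟩
  · rw [← history_eq_answer ω h1]
    simp only [answer, next]
    rw [if_pos h1]
  · rw [h1]

theorem src_src (h : ℕ) : I.src (I.src h) = I.src h := by
  rcases I.isSource h with ⟨-, h1, -⟩ | ⟨h1, -⟩
  · exact h1
  · rw [h1, h1]

theorem src_le (h : ℕ) : I.src h ≤ h := by
  rcases I.isSource h with ⟨h1, -, -⟩ | ⟨h1, -⟩
  · exact h1.le
  · exact h1.le

theorem log_div_sqrt_nonneg : 0 ≤ Real.log I.T / √I.T :=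
  div_nonneg (Real.log_natCast_nonneg _) (Real.sqrt_nonneg _)

theorem norm_sub_src_le (h : ℕ) : ‖I.z h - I.z (I.src h)‖ ≤ Real.log I.T / √I.T := by
  rcases I.isSource h with ⟨-, -, h1⟩ | ⟨h1, -⟩
  · exact h1
  · rw [h1, sub_self, norm_zero]; exact log_div_sqrt_nonneg

theorem released_anti {j h : ℕ} (hjh : j ≤ h) : I.released κ ρ h ⊆ I.released κ ρ j :=
  fun _ hω i hi => hω i (hi.trans hjh)

theorem history_congr {ω ω' : Noise n} {h : ℕ} (hω : ∀ i < h, ω i = ω' i) :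
    I.history κ ρ ω h = I.history κ ρ ω' h := by
  induction h with
  | zero => rfl
  | succ h ih =>
    simp only [history]
    rw [ih fun i hi => hω i (by omega), hω h (by omega)]

theorem answer_congr {ω ω' : Noise n} {h : ℕ} (hω : ∀ i ≤ h, ω i = ω' i) :
    I.answer κ ρ h ω = I.answer κ ρ h ω' := by
  simp only [answer]
  rw [history_congr fun i hi => hω i hi.le, hω h le_rfl]

/-- Whether the answer to query `h` is released does not depend on the Gaussian noise used for it. -/
theorem mem_released_congr {ω ω' : Noise n} {h : ℕ} (hω : ∀ i < h, ω i = ω' i)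
    (hu : (ω h).2 = (ω' h).2) : ω ∈ I.released κ ρ h ↔ ω' ∈ I.released κ ρ h := by
  have hused : ∀ i ≤ h, I.used κ ρ ω i = I.used κ ρ ω' i := fun i hi => by
    have hu' : (ω i).2 = (ω' i).2 := by
      rcases hi.eq_or_lt with rfl | hi'
      · exact hu
      · rw [hω i hi']
    unfold used
    rw [history_congr fun k hk => hω k (by omega), hu']
  simp only [released, Set.mem_ofPred_eq]
  refine forall_congr' fun j => forall_congr' fun hj => forall_congr' fun _ => ?_
  have : (fun i : Fin (j + 1) => I.used κ ρ ω i) = fun i : Fin (j + 1) => I.used κ ρ ω' i := by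
    funext i
    exact hused i (by omega)
  rw [this]

end Input

end Measurability

/-! ### Separating the noise of one query from the past -/

instance (n : ℕ) : IsProbabilityMeasure (noiseLaw n) := by
  unfold noiseLaw; infer_instance

section Truncate

variable {n : ℕ}

/-- The noise of the queries before `h`; all later entries are `0`. -/
def truncate (h : ℕ) (ω : Noise n) (i : ℕ) : (ℕ → Pt n) × unitInterval := if i < h then ω i else 0

theorem measurable_truncate (h : ℕ) : Measurable (truncate h : Noise n → Noise n) := by
  refine measurable_pi_lambda _ fun i => ?_
  unfold truncate
  split_ifs
  · exact measurable_pi_apply i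
  · exact measurable_const

theorem map_truncate_prod (h : ℕ) :
    (noiseLaw n).map (fun ω => (truncate h ω, ω h)) =
      ((noiseLaw n).map (truncate h)).prod ((gaussianSeq n).prod volume) := by
  have hind : iIndepFun (fun (i : ℕ) (ω : Noise n) => ω i) (noiseLaw n) :=
    iIndepFun_infinitePi (X := fun _ => id) fun _ => measurable_id
  have h1 := hind.indepFun_finset (Finset.range h) {h} (by simp) fun i => measurable_pi_apply i
  let F : (Finset.range h → (ℕ → Pt n) × unitInterval) → Noise n := fun a i =>
    if hi : i < h then a ⟨i, Finset.mem_range.2 hi⟩ else 0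
  have hF : Measurable F := by
    refine measurable_pi_lambda _ fun i => ?_
    simp only [F]
    split_ifs
    · exact measurable_pi_apply _
    · exact measurable_const
  let G : (({h} : Finset ℕ) → (ℕ → Pt n) × unitInterval) → (ℕ → Pt n) × unitInterval :=
    fun a => a ⟨h, Finset.mem_singleton_self h⟩
  have hG : Measurable G := measurable_pi_apply _
  have h2 : IndepFun (truncate h) (fun ω : Noise n => ω h) (noiseLaw n) := by
    have h3 := h1.comp hF hG
    have e : (F ∘ fun (ω : Noise n) (i : Finset.range h) => ω i) = truncate h := by
      funext ω i
      simp [F, truncate]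
    rw [e] at h3
    exact h3
  rw [h2.map_prod_eq_prod_map_map (measurable_truncate h).aemeasurable
    (measurable_pi_apply h).aemeasurable]
  congr 1
  exact Measure.infinitePi_map_eval _ h

/-- If the integral of a function of the noise up to query `h` over the Gaussian noise of query `h`
is never positive, then neither is its expectation. -/
theorem integral_noiseLaw_nonpos {F : Noise n → ℝ} (hF : Measurable F) {b : ℝ}
    (hb : ∀ ω, ‖F ω‖ ≤ b) {h : ℕ} (hcongr : ∀ ω ω', (∀ i ≤ h, ω i = ω' i) → F ω = F ω')
    (hint : ∀ (ω : Noise n) (u : unitInterval),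
      ∫ Z, F (Function.update ω h (Z, u)) ∂(gaussianSeq n) ≤ 0) :
    ∫ ω, F ω ∂(noiseLaw n) ≤ 0 := by
  let H : Noise n × ((ℕ → Pt n) × unitInterval) → ℝ := fun p => F (Function.update p.1 h p.2)
  have hH : Measurable H := by
    refine hF.comp (measurable_pi_lambda _ fun i => ?_)
    simp only [Function.update_apply]
    split_ifs
    · exact measurable_snd
    · exact (measurable_pi_apply i).comp measurable_fst
  have h1 : ∀ ω : Noise n, F ω = H (truncate h ω, ω h) := fun ω => by
    refine hcongr _ _ fun i hi => ?_
    rw [Function.update_apply]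
    split_ifs with hih
    · rw [hih]
    · simp only [truncate]
      rw [if_pos (by omega)]
  have : IsProbabilityMeasure ((noiseLaw n).map (truncate h)) :=
    Measure.isProbabilityMeasure_map (measurable_truncate h).aemeasurable
  simp only [h1]
  rw [← integral_map (φ := fun ω : Noise n => (truncate h ω, ω h))
    ((measurable_truncate h).prodMk (measurable_pi_apply h)).aemeasurable
    hH.aestronglyMeasurable, map_truncate_prod, integral_prod]
  · refine integral_nonpos fun ω => ?_
    change ∫ ζ, H (ω, ζ) ∂((gaussianSeq n).prod volume) ≤ 0
    rw [integral_prod_symm]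
    · exact integral_nonpos fun u => hint ω u
    · exact Integrable.of_bound (hH.comp measurable_prodMk_left).aestronglyMeasurable b
        (Filter.Eventually.of_forall fun ζ => hb _)
  · exact Integrable.of_bound hH.aestronglyMeasurable b (Filter.Eventually.of_forall fun p => hb _)

end Truncate

/-! ### Utility of the protocol -/

theorem epsIte_pos {T : ℕ} (hT : 2 ≤ T) {εmin δmin : ℝ} (hε : 0 < εmin) (hδ : 0 < δmin)
    (hδ1 : δmin < 1) : 0 < epsIte T εmin δmin := by
  have h1 : 0 < Real.log (2 / δmin) := Real.log_pos (by rw [one_lt_div hδ]; linarith)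
  have h2 : (0 : ℝ) < T := by positivity
  unfold epsIte
  positivity

theorem sigmaMin_pos {m T : ℕ} (hm : 0 < m) (hT : 2 ≤ T) {εmin δmin : ℝ} (hε : 0 < εmin)
    (hδ : 0 < δmin) (hδ1 : δmin < 1) : 0 < sigmaMin m T εmin δmin := by
  have h2 : (2 : ℝ) ≤ T := by exact_mod_cast hT
  have h1 : 0 < Real.log (2.5 * T / δmin) := Real.log_pos (by
    rw [one_lt_div hδ]; linarith)
  have h3 := epsIte_pos hT hε hδ hδ1
  have h4 : (0 : ℝ) < m := by exact_mod_cast hm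
  unfold sigmaMin
  positivity

namespace Input

variable {κ : ℝ} {n m : ℕ} {I : Input n m}

theorem sigmaMin_pos (I : Input n m) (hm : 0 < m) : 0 < sigmaMin m I.T I.εmin I.δmin :=
  AdaptiveDP.sigmaMin_pos hm I.two_le_T I.εmin_pos I.δmin_pos I.δmin_lt

/-- Accuracy of gradient descent for query `h`, whatever the earlier explanations are and whichever
of them is sampled: the chosen noise level fits the gradient at the initial point. -/
theorem next_excess_le (hκ : 0 < κ) (hn : 0 < n) (hm : 0 < m) {K : ℝ}
    (hK : √n * sigmaMin m I.T I.εmin I.δmin ≤ K) {h : ℕ} (hsrc : I.src h = h) {past : ℕ → Pt n}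
    (hp : ∀ j, ‖past j‖ ≤ 1) (u : unitInterval) :
    ∫ Z, (loss κ I.x I.f (I.z h) (I.next κ (rateRule κ) h past (Z, u)) -
      optLoss κ I.x I.f (I.z h)) ∂(gaussianSeq n) ≤
        runConst κ (max κ K) * (Real.log I.T / √I.T) := by
  have hσ := I.sigmaMin_pos hm
  have hn' : 0 < √(n : ℝ) := Real.sqrt_pos.2 (by exact_mod_cast hn)
  have hstart := norm_params_le (κ := κ) (I := I) (h := h) hp u
  simp only [next, hsrc, lt_irrefl, if_false]
  have hpar : 0 < √n * (I.params κ h past u).2.1 ∧ √n * (I.params κ h past u).2.1 ≤ max κ K ∧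
      ((I.params κ h past u).2.2 = I.T ∨
        (I.params κ h past u).2.2 = warmIters n I.T (I.params κ h past u).2.1 ∧
        ‖lossGrad κ I.x I.f (I.z h) (I.params κ h past u).1‖ ≤
          √n * (I.params κ h past u).2.1) := by
    unfold params at hstart ⊢
    split_ifs at hstart ⊢ with h0
    · exact ⟨mul_pos hn' hσ, hK.trans (le_max_right _ _), Or.inl rfl⟩
    · simp only at hstart ⊢
      refine ⟨mul_pos hn' (lt_max_of_lt_right hσ), ?_, Or.inr ⟨trivial, ?_⟩⟩
      · rw [mul_max_of_nonneg _ _ hn'.le, mul_div_cancel₀ _ hn'.ne']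
        exact max_le_max (norm_lossGrad_le hκ I.label_le hstart) hK
      · rw [mul_max_of_nonneg _ _ hn'.le, mul_div_cancel₀ _ hn'.ne']
        exact le_max_left _ _
  exact run_excess_le hκ I.label_le hstart hpar.1 hpar.2.1 I.two_le_T _ hpar.2.2

theorem integrable_answerLoss (hκ : 0 < κ) (h : ℕ) :
    Integrable (I.answerLoss κ (rateRule κ) h) (noiseLaw n) :=
  integrable_of_ball continuous_loss (I.measurable_answer hκ h) fun ω => norm_answer_le ω h

/-- Expected excess loss of a gradient descent output on the event of its release. -/
theorem setIntegral_source_excess_le (hκ : 0 < κ) (hn : 0 < n) (hm : 0 < m) {K : ℝ}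
    (hK : √n * sigmaMin m I.T I.εmin I.δmin ≤ K) {h : ℕ} (hsrc : I.src h = h) :
    ∫ ω in I.released κ (rateRule κ) h, (I.answerLoss κ (rateRule κ) h ω -
      optLoss κ I.x I.f (I.z h)) ∂(noiseLaw n) ≤
        runConst κ (max κ K) * (Real.log I.T / √I.T) *
          (noiseLaw n).real (I.released κ (rateRule κ) h) := by
  set R := I.released κ (rateRule κ) h with hR
  set B := runConst κ (max κ K) * (Real.log I.T / √I.T) with hBdef
  set l := optLoss κ I.x I.f (I.z h) with hl
  have hRm : MeasurableSet R := I.measurableSet_released hκ h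
  have hLm : Measurable (I.answerLoss κ (rateRule κ) h) :=
    continuous_loss.measurable.comp (I.measurable_answer hκ h)
  have hB0 : 0 ≤ B := mul_nonneg (runConst_nonneg hκ _) log_div_sqrt_nonneg
  have key : ∫ ω, R.indicator (fun ω => I.answerLoss κ (rateRule κ) h ω - l - B) ω
      ∂(noiseLaw n) ≤ 0 := by
    refine integral_noiseLaw_nonpos (b := 1 + κ + B) (h := h)
      (((hLm.sub_const l).sub_const B).indicator hRm) (fun ω => ?_) (fun ω ω' hω => ?_)
      (fun ω u => ?_)
    · have h1 : I.answerLoss κ (rateRule κ) h ω ≤ 1 + κ :=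
        loss_le hκ I.label_le (norm_answer_le ω h)
      have h2 : l ≤ I.answerLoss κ (rateRule κ) h ω := optLoss_le (norm_answer_le ω h)
      have h3 : 0 ≤ l := optLoss_nonneg hκ
      refine (norm_indicator_le_norm_self _ ω).trans ?_
      rw [Real.norm_eq_abs, abs_le]
      constructor <;> linarith
    · have h1 := mem_released_congr (I := I) (κ := κ) (ρ := rateRule κ) (h := h)
        (fun i hi => hω i hi.le) (by rw [hω h le_rfl])
      have h2 : I.answerLoss κ (rateRule κ) h ω = I.answerLoss κ (rateRule κ) h ω' := by
        unfold answerLoss; rw [answer_congr hω]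
      by_cases hmem : ω ∈ R
      · rw [Set.indicator_of_mem hmem, Set.indicator_of_mem (h1.1 hmem), h2]
      · rw [Set.indicator_of_notMem hmem, Set.indicator_of_notMem (fun hc => hmem (h1.2 hc))]
    · -- the release is decided before the noise vectors `Z` are drawn
      have h1 : ∀ Z : ℕ → Pt n, (Function.update ω h (Z, u) ∈ R ↔
          Function.update ω h (0, u) ∈ R) := fun Z =>
        mem_released_congr (fun i hi => by
          rw [Function.update_of_ne hi.ne, Function.update_of_ne hi.ne])
          (by rw [Function.update_self, Function.update_self])
      by_cases hmem : Function.update ω h (0, u) ∈ R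
      · have h2 : ∀ Z : ℕ → Pt n, R.indicator
            (fun ω => I.answerLoss κ (rateRule κ) h ω - l - B) (Function.update ω h (Z, u)) =
            loss κ I.x I.f (I.z h) (I.next κ (rateRule κ) h
              (I.history κ (rateRule κ) ω h) (Z, u)) - l - B := fun Z => by
          rw [Set.indicator_of_mem ((h1 Z).2 hmem)]
          simp only [answerLoss, answer]
          rw [history_congr (ω' := ω) fun i hi => Function.update_of_ne hi.ne _ _,
            Function.update_self]
        simp only [h2]
        have hnext : Measurable fun Z : ℕ → Pt n => I.next κ (rateRule κ) h
            (I.history κ (rateRule κ) ω h) (Z, u) :=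
          I.measurable_next hκ h (past := fun _ => I.history κ (rateRule κ) ω h)
            (ζ := fun Z => (Z, u)) (fun j => measurable_const)
            (measurable_id.prodMk measurable_const)
        have h3 : Integrable (fun Z : ℕ → Pt n => loss κ I.x I.f (I.z h) (I.next κ (rateRule κ) h
              (I.history κ (rateRule κ) ω h) (Z, u)) - l) (gaussianSeq n) :=
          (integrable_of_ball continuous_loss hnext
            fun Z => norm_next_le (norm_history_le ω h) _).sub (integrable_const l)
        rw [integral_sub h3 (integrable_const B), integral_const, probReal_univ, one_smul]
        linarith [next_excess_le hκ hn hm hK hsrc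
          (norm_history_le (I := I) (κ := κ) (ρ := rateRule κ) ω h) u]
      · have h2 : ∀ Z : ℕ → Pt n, R.indicator
            (fun ω => I.answerLoss κ (rateRule κ) h ω - l - B) (Function.update ω h (Z, u)) = 0 :=
          fun Z => Set.indicator_of_notMem (fun hc => hmem ((h1 Z).1 hc)) _
        simp [h2]
  have hint : Integrable (fun ω => I.answerLoss κ (rateRule κ) h ω - l)
      ((noiseLaw n).restrict R) :=
    (I.integrable_answerLoss hκ h).integrableOn.sub (integrable_const l)
  rw [integral_indicator hRm, integral_sub hint (integrable_const B), setIntegral_const,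
    smul_eq_mul] at key
  linarith

/-- The constant in the accuracy of the protocol, when `√n σ_min ≤ K`. -/
def utilityConst (κ K : ℝ) : ℝ := runConst κ (max κ K) + 2 * queryLip κ

theorem utilityConst_nonneg (hκ : 0 < κ) (K : ℝ) : 0 ≤ utilityConst κ K :=
  add_nonneg (runConst_nonneg hκ _) (mul_nonneg zero_le_two (queryLip_nonneg hκ))

/-- Expected excess loss of any explanation, new or reused, on the event that its source was
released. -/
theorem setIntegral_excess_le (hκ : 0 < κ) (hn : 0 < n) (hm : 0 < m) {K : ℝ}
    (hK : √n * sigmaMin m I.T I.εmin I.δmin ≤ K) (h : ℕ) :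
    ∫ ω in I.released κ (rateRule κ) (I.src h), (I.answerLoss κ (rateRule κ) h ω -
      optLoss κ I.x I.f (I.z h)) ∂(noiseLaw n) ≤
        utilityConst κ K * (Real.log I.T / √I.T) *
          (noiseLaw n).real (I.released κ (rateRule κ) (I.src h)) := by
  have h1 := setIntegral_source_excess_le (I := I) hκ hn hm hK (src_src h)
  set R := I.released κ (rateRule κ) (I.src h)
  set q := Real.log I.T / √I.T with hq
  have hd := mul_le_mul_of_nonneg_left (norm_sub_src_le (I := I) h) (queryLip_nonneg hκ)
  have hpt : ∀ ω, I.answerLoss κ (rateRule κ) h ω - optLoss κ I.x I.f (I.z h) ≤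
      (I.answerLoss κ (rateRule κ) (I.src h) ω - optLoss κ I.x I.f (I.z (I.src h))) +
        2 * queryLip κ * q := fun ω => by
    have h2 := loss_le_loss_add (x := I.x) (f := I.f) hκ I.label_le
      (norm_answer_le (κ := κ) (ρ := rateRule κ) (I := I) ω h) (I.z h) (I.z (I.src h))
    have h3 := optLoss_le_optLoss_add (x := I.x) (f := I.f) hκ I.label_le (I.z (I.src h)) (I.z h)
    rw [norm_sub_rev] at h3
    have h4 : I.answerLoss κ (rateRule κ) (I.src h) ω =
        loss κ I.x I.f (I.z (I.src h)) (I.answer κ (rateRule κ) h ω) := by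
      rw [answer_eq_answer_src ω h]; rfl
    rw [h4]
    simp only [answerLoss]
    linarith
  have i1 : Integrable (fun ω => I.answerLoss κ (rateRule κ) h ω - optLoss κ I.x I.f (I.z h))
      ((noiseLaw n).restrict R) :=
    (I.integrable_answerLoss hκ h).integrableOn.sub (integrable_const _)
  have i2 : Integrable (fun ω => I.answerLoss κ (rateRule κ) (I.src h) ω -
      optLoss κ I.x I.f (I.z (I.src h))) ((noiseLaw n).restrict R) :=
    (I.integrable_answerLoss hκ _).integrableOn.sub (integrable_const _)
  have h5 := integral_mono i1 (i2.add (integrable_const (2 * queryLip κ * q))) hpt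
  rw [integral_add' i2 (integrable_const _), setIntegral_const, smul_eq_mul] at h5
  unfold utilityConst
  linarith

theorem utilityBound (hκ : 0 < κ) (hn : 0 < n) (hm : 0 < m) {K : ℝ}
    (hK : √n * sigmaMin m I.T I.εmin I.δmin ≤ K) :
    I.UtilityBound κ (rateRule κ) (utilityConst κ K * (Real.log I.T / √I.T)) := by
  intro h
  have hB0 : 0 ≤ utilityConst κ K * (Real.log I.T / √I.T) :=
    mul_nonneg (utilityConst_nonneg hκ K) log_div_sqrt_nonneg
  have key := setIntegral_excess_le (I := I) hκ hn hm hK h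
  refine ⟨I.integrable_answerLoss hκ h, I.measurableSet_released hκ h, ?_, ?_⟩
  · unfold utilityLoss
    set R := I.released κ (rateRule κ) (I.src h)
    rw [integral_sub (I.integrable_answerLoss hκ h).integrableOn (integrable_const _),
      setIntegral_const, smul_eq_mul] at key
    by_cases h0 : (noiseLaw n) R = 0
    · -- conditioning on a null event gives the zero measure
      rw [cond_eq_zero_of_meas_eq_zero h0, integral_zero_measure]
      linarith [optLoss_nonneg (x := I.x) (f := I.f) (z := I.z h) hκ]
    · have hp : 0 < (noiseLaw n).real R := by
        rw [measureReal_def]; exact ENNReal.toReal_pos h0 (measure_ne_top _ _)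
      have hc : ∫ ω, I.answerLoss κ (rateRule κ) h ω ∂(noiseLaw n)[|R] =
          ((noiseLaw n).real R)⁻¹ * ∫ ω in R, I.answerLoss κ (rateRule κ) h ω ∂(noiseLaw n) := by
        rw [ProbabilityTheory.cond, integral_smul_measure, ENNReal.toReal_inv, smul_eq_mul, measureReal_def]
      rw [hc, sub_le_iff_le_add, inv_mul_le_iff₀ hp]
      linarith
  · have h1 : ∫ ω in I.released κ (rateRule κ) h, (I.answerLoss κ (rateRule κ) h ω -
        optLoss κ I.x I.f (I.z h)) ∂(noiseLaw n) ≤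
        ∫ ω in I.released κ (rateRule κ) (I.src h), (I.answerLoss κ (rateRule κ) h ω -
        optLoss κ I.x I.f (I.z h)) ∂(noiseLaw n) :=
      setIntegral_mono_set ((I.integrable_answerLoss hκ h).integrableOn.sub (integrable_const _))
        (Filter.Eventually.of_forall fun ω => sub_nonneg.2 (optLoss_le (norm_answer_le ω h)))
        (released_anti (src_le h)).eventuallyLE
    exact h1.trans (key.trans (mul_le_of_le_one_right hB0 measureReal_le_one))

end Input

/-! ### The regime `T = √m` -/

/-- For `T ≈ √m`, the noise level is bounded as soon as `n < m ε_ite`. -/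
theorem sqrt_mul_sigmaMin_le {n m T : ℕ} {εmin δmin : ℝ} (hm : 0 < m) (hT : 2 ≤ T) (hε : 0 < εmin)
    (hδ : 0 < δmin) (hδ1 : δmin < 1) (hn : n / epsIte T εmin δmin < m)
    (hTm : |(T : ℝ) - √m| < 1) :
    √n * sigmaMin m T εmin δmin ≤ √(20 * √(8 * Real.log (2 / δmin)) / (δmin * εmin)) := by
  have hi := epsIte_pos hT hε hδ hδ1
  have hm' : (0 : ℝ) < m := by exact_mod_cast hm
  have hT2 : (2 : ℝ) ≤ T := by exact_mod_cast hT
  have hΛ : 0 < Real.log (2 / δmin) := Real.log_pos (by rw [one_lt_div hδ]; linarith)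
  have hl0 : 0 < Real.log (2.5 * T / δmin) := Real.log_pos (by rw [one_lt_div hδ]; linarith)
  have hl : Real.log (2.5 * T / δmin) ≤ 2.5 * T / δmin := by
    have := Real.log_le_sub_one_of_pos (show 0 < 2.5 * (T : ℝ) / δmin by positivity)
    linarith
  have hmT : (T : ℝ) ^ 2 ≤ 4 * m := by
    have h1 : (T : ℝ) ≤ 2 * √m := by linarith [(abs_lt.1 hTm).2]
    have h2 := pow_le_pow_left₀ (by positivity) h1 2
    rw [mul_pow, Real.sq_sqrt hm'.le] at h2
    linarith
  have hTs : √(T : ℝ) ≤ T := by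
    rw [Real.sqrt_le_left (by positivity)]; nlinarith
  rw [div_lt_iff₀ hi] at hn
  set L := Real.log (2.5 * T / δmin)
  have hsplit : √(8 * T * Real.log (2 / δmin)) = √T * √(8 * Real.log (2 / δmin)) := by
    rw [← Real.sqrt_mul (by positivity)]; congr 1; ring
  have hinv : 1 / (m * epsIte T εmin δmin) = √T * √(8 * Real.log (2 / δmin)) / (m * εmin) := by
    unfold epsIte
    rw [hsplit]
    field_simp
  apply Real.le_sqrt_of_sq_le
  set q := √(8 * Real.log (2 / δmin))
  calc (√n * sigmaMin m T εmin δmin) ^ 2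
      = n * (2 * L) / (m * epsIte T εmin δmin) ^ 2 := by
        unfold sigmaMin
        rw [mul_pow, div_pow, Real.sq_sqrt (Nat.cast_nonneg n), Real.sq_sqrt (by positivity)]
        ring
    _ ≤ (m * epsIte T εmin δmin) * (2 * (2.5 * T / δmin)) / (m * epsIte T εmin δmin) ^ 2 := by
        gcongr
    _ = 5 * T / δmin * (1 / (m * epsIte T εmin δmin)) := by
        field_simp; norm_num
    _ = 5 * (T * √T) * q / (δmin * εmin) / m := by
        rw [hinv]; field_simp
    _ ≤ 5 * (T * T) * q / (δmin * εmin) / m := by gcongr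
    _ = 5 * T ^ 2 * q / (δmin * εmin) / m := by ring
    _ ≤ 5 * (4 * m) * q / (δmin * εmin) / m := by gcongr
    _ = _ := by field_simp; ring

theorem log_div_sqrt_le {m T : ℕ} (hT : 2 ≤ T) (hTm : |(T : ℝ) - √m| < 1) :
    Real.log T / √T ≤ 2 * (Real.log m / (m : ℝ) ^ (1 / 4 : ℝ)) := by
  obtain ⟨h1, h2⟩ := abs_lt.1 hTm
  have hT2 : (2 : ℝ) ≤ T := by exact_mod_cast hT
  have hm : (0 : ℝ) < m := Real.sqrt_pos.1 (by linarith)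
  have hm1 : (1 : ℝ) ≤ m := by exact_mod_cast (show 0 < m by exact_mod_cast hm)
  have hsm : √(m : ℝ) ≤ m := by
    rw [Real.sqrt_le_left hm.le]; nlinarith
  have hTm' : T ≤ m := by
    have : (T : ℝ) < m + 1 := by linarith
    have : T < m + 1 := by exact_mod_cast this
    omega
  have hlog : Real.log T ≤ Real.log m :=
    Real.log_le_log (by linarith) (by exact_mod_cast hTm')
  have hq : (m : ℝ) ^ (1 / 4 : ℝ) = √(√m) := by
    rw [Real.sqrt_eq_rpow, Real.sqrt_eq_rpow, ← Real.rpow_mul hm.le]; norm_num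
  have hqT : √(√(m : ℝ)) ≤ 2 * √T := by
    rw [Real.sqrt_le_left (by positivity), mul_pow, Real.sq_sqrt (by positivity)]
    linarith
  have hq0 : 0 < √(√(m : ℝ)) := Real.sqrt_pos.2 (Real.sqrt_pos.2 hm)
  rw [hq, ← mul_div_assoc, div_le_div_iff₀ (Real.sqrt_pos.2 (by linarith)) hq0]
  have h0 := Real.log_natCast_nonneg m
  calc Real.log T * √√m ≤ Real.log m * (2 * √T) := by gcongr
    _ = _ := by ring

theorem Input.UtilityBound.mono {κ : ℝ} {ρ : RateRule} {n m : ℕ} {I : Input n m} {B B' : ℝ}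
    (h : I.UtilityBound κ ρ B) (hB : B ≤ B') : I.UtilityBound κ ρ B' := fun k =>
  ⟨(h k).1, (h k).2.1, (h k).2.2.1.trans hB, (h k).2.2.2.trans hB⟩

end AdaptiveDP

end

theorem theorem4 (κ : ℝ) (hκ : 0 < κ) :
    ∃ ρ : AdaptiveDP.RateRule, (∀ n T T' σ β, 0 < ρ n T T' σ β) ∧
      (∀ K : ℝ, ∃ C : ℝ, ∀ (n m : ℕ) (I : AdaptiveDP.Input n m), 0 < n → 0 < m →
        √n * AdaptiveDP.sigmaMin m I.T I.εmin I.δmin ≤ K →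
        I.UtilityBound κ ρ (C * (Real.log I.T / √I.T))) ∧
      (∀ εmin δmin : ℝ, 0 < εmin → 0 < δmin → δmin < 1 →
        ∃ C : ℝ, ∀ (n m : ℕ) (I : AdaptiveDP.Input n m), 0 < n → 0 < m →
        I.εmin = εmin → I.δmin = δmin →
        n / AdaptiveDP.epsIte I.T I.εmin I.δmin < m → |(I.T : ℝ) - √m| < 1 →
        I.UtilityBound κ ρ (C * (Real.log m / (m : ℝ) ^ (1 / 4 : ℝ)))) := by
  refine ⟨AdaptiveDP.rateRule κ, AdaptiveDP.rateRule_pos hκ,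
    fun K => ⟨AdaptiveDP.Input.utilityConst κ K, fun n m I hn hm hK =>
      AdaptiveDP.Input.utilityBound hκ hn hm hK⟩, fun εmin δmin hε hδ hδ1 =>
    ⟨AdaptiveDP.Input.utilityConst κ (√(20 * √(8 * Real.log (2 / δmin)) / (δmin * εmin))) * 2,
      fun n m I hn hm h1 h2 hnm hT => ?_⟩⟩
  subst h1 h2
  refine (AdaptiveDP.Input.utilityBound hκ hn hm (AdaptiveDP.sqrt_mul_sigmaMin_le hm I.two_le_T hε hδ
    hδ1 hnm hT)).mono ?_
  rw [mul_assoc]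
  exact mul_le_mul_of_nonneg_left (AdaptiveDP.log_div_sqrt_le I.two_le_T hT)
    (AdaptiveDP.Input.utilityConst_nonneg hκ _)
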